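/- Let $\Bbbk$ be a field of characteristic zero, let $S=\Bbbk[x,y]$, let $r\geq -1$ be an integer and let $\mathcal A$ be a central arrangement of $r+2$ lines in the plane $\Bbbk^2$, one of which is the line $x=0$. Let $Q=xF\in S$ be a defining polynomial of $\mathcal A$, that is, a product of linear forms, one for each line of $\mathcal A$ and vanishing exactly on that line. Let $\operatorname{Der}(\mathcal A)=\{\delta\in\operatorname{Der}_\Bbbk(S):\delta(Q)\in QS\}$, and let $A=\mathcal D(\mathcal A)$ be the subalgebra of $\operatorname{End}_\Bbbk(S)$ generated by the multiplications by elements of $S$ and by $\operatorname{Der}(\mathcal A)$. The derivations $E=x\partial_x+y\partial_y$ and $D=F\partial_y$ belong to $\operatorname{Der}(\mathcal A)$. Write $F_y=\partial_yF$, and let $A^e=A\otimes_\Bbbk A^{\mathrm{op}}$ be the enveloping algebra, whose left modules are the $A$-bimodules. Then there is a $\Bbbk$-algebra automorphism $\sigma:A\to A$ such that $$\sigma(x)=x,\qquad \sigma(y)=y,\qquad \sigma(D)=D+F_y,\qquad \sigma(E)=E+r+2,$$ and $A$ is twisted Calabi–Yau of dimension $4$ with modular automorphism $\sigma$; that is: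 1. $A$ has a resolution of finite length by finitely generated projective $A$-bimodules; 2. $\operatorname{Ext}^i_{A^e}(A,A^e)=0$ for all $i\neq4$; 3. $\operatorname{Ext}^4_{A^e}(A,A^e)\cong A_\sigma$ as $A$-bimodules. Here the bimodule structure on $\operatorname{Ext}^4_{A^e}(A,A^e)$ is the one induced by the inner bimodule structure $a\cdot(c\otimes d)\cdot b=cb\otimes ad$ of $A^e$, and $A_\sigma$ is the vector space $A$ with $a\triangleright u\triangleleft b=a\,u\,\sigma(b)$. -/

import Mathlib

open scoped TensorProduct
open MvPolynomial MulOpposite CategoryTheory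

universe u v

/-! ### Bimodules over an algebra and the twisted Calabi-Yau property -/

section Bimodules

variable (k : Type v) [Field k] (A : Type u) [Ring A] [Algebra k A]

/-- The enveloping algebra `A ⊗ Aᵒᵖ`; its left modules are the `A`-bimodules (on which `k` acts
centrally), with `(a ⊗ b) m = a m b`. -/
abbrev EnvAlg : Type u := A ⊗[k] Aᵐᵒᵖ

/-- The algebra `A` as a bimodule over itself. -/
noncomputable def regularBimodule : ModuleCat.{u} (EnvAlg k A) :=
  letI : Module (EnvAlg k A) A := instModuleTensorProductMop k A
  ModuleCat.of (EnvAlg k A) A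

/-- The enveloping algebra as a left module over itself, that is, the bimodule `A ⊗ A` with the
outer bimodule structure. -/
noncomputable def envBimodule : ModuleCat.{u} (EnvAlg k A) :=
  ModuleCat.of (EnvAlg k A) (EnvAlg k A)

/-- The anti-automorphism `a ⊗ b ↦ b ⊗ a` of the enveloping algebra. -/
noncomputable def envFlip : EnvAlg k A →ₐ[k] (EnvAlg k A)ᵐᵒᵖ :=
  Algebra.TensorProduct.lift
    (AlgHom.opComm.symm (Algebra.TensorProduct.includeRight : Aᵐᵒᵖ →ₐ[k] EnvAlg k A))
    (AlgHom.op (Algebra.TensorProduct.includeLeft : A →ₐ[k] EnvAlg k A))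
    (fun a b => by
      apply MulOpposite.unop_injective
      simp [AlgHom.opComm])

theorem envFlip_tmul (a b : A) :
    envFlip k A (a ⊗ₜ[k] op b) = op (b ⊗ₜ[k] op a) := by
  apply MulOpposite.unop_injective
  simp [envFlip, AlgHom.opComm]

/-- Right multiplication by an element of the enveloping algebra (the inner bimodule structure),
as an endomorphism of the left module `envBimodule`. -/
noncomputable def envRightMul (w : EnvAlg k A) : envBimodule k A ⟶ envBimodule k A :=
  ModuleCat.ofHom (LinearMap.toSpanSingleton (EnvAlg k A) (EnvAlg k A) w)

theorem envRightMul_apply (w z : EnvAlg k A) :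
    (envRightMul k A w).hom z = (z * w : EnvAlg k A) := rfl

theorem envRightMul_one : envRightMul k A 1 = 𝟙 _ := by
  exact ModuleCat.hom_ext (LinearMap.ext fun z => mul_one (M := EnvAlg k A) z)

theorem envRightMul_mul (w w' : EnvAlg k A) :
    envRightMul k A (w * w') = envRightMul k A w ≫ envRightMul k A w' := by
  exact ModuleCat.hom_ext (LinearMap.ext fun z => (mul_assoc (G := EnvAlg k A) z w w').symm)

theorem envRightMul_add (w w' : EnvAlg k A) :
    envRightMul k A (w + w') = envRightMul k A w + envRightMul k A w' := by
  exact ModuleCat.hom_ext (LinearMap.ext fun z => mul_add (R := EnvAlg k A) z w w')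

theorem envRightMul_zero : envRightMul k A 0 = 0 := by
  exact ModuleCat.hom_ext (LinearMap.ext fun z => mul_zero (M₀ := EnvAlg k A) z)

/-- `Ext^i_{Aᵉ}(A, Aᵉ)`. -/
def ExtEnv (i : ℕ) : Type u :=
  Abelian.Ext.{u} (regularBimodule k A) (envBimodule k A) i

noncomputable instance (i : ℕ) : AddCommGroup (ExtEnv k A i) :=
  inferInstanceAs (AddCommGroup (Abelian.Ext.{u} (regularBimodule k A) (envBimodule k A) i))

/-- The map induced on `Ext^i_{Aᵉ}(A, Aᵉ)` by an endomorphism of `Aᵉ`. -/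
noncomputable def extEnvMap (i : ℕ) (f : envBimodule k A ⟶ envBimodule k A) :
    AddMonoid.End (ExtEnv k A i) :=
  ((Abelian.Ext.mk₀ f).postcomp (regularBimodule k A) (add_zero i) :
    Abelian.Ext.{u} (regularBimodule k A) (envBimodule k A) i →+
      Abelian.Ext.{u} (regularBimodule k A) (envBimodule k A) i)

theorem extEnvMap_apply (i : ℕ) (f : envBimodule k A ⟶ envBimodule k A)
    (e : Abelian.Ext.{u} (regularBimodule k A) (envBimodule k A) i) :
    extEnvMap k A i f e = e.comp (Abelian.Ext.mk₀ f) (add_zero i) := rfl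

theorem extEnvMap_id (i : ℕ) : extEnvMap k A i (𝟙 _) = 1 :=
  AddMonoidHom.ext fun e => Abelian.Ext.comp_mk₀_id e

theorem extEnvMap_comp (i : ℕ) (f g : envBimodule k A ⟶ envBimodule k A) :
    extEnvMap k A i (f ≫ g) = extEnvMap k A i g * extEnvMap k A i f := by
  refine AddMonoidHom.ext fun (e : Abelian.Ext.{u} (regularBimodule k A) (envBimodule k A) i) => ?_
  change e.comp (Abelian.Ext.mk₀ (f ≫ g)) (add_zero i) =
    (e.comp (Abelian.Ext.mk₀ f) (add_zero i)).comp (Abelian.Ext.mk₀ g) (add_zero i)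
  rw [← Abelian.Ext.mk₀_comp_mk₀, Abelian.Ext.comp_assoc_of_third_deg_zero]

theorem extEnvMap_zero (i : ℕ) : extEnvMap k A i 0 = 0 := by
  refine AddMonoidHom.ext fun (e : Abelian.Ext.{u} (regularBimodule k A) (envBimodule k A) i) => ?_
  change e.comp (Abelian.Ext.mk₀ 0) (add_zero i) = 0
  rw [Abelian.Ext.mk₀_zero, Abelian.Ext.comp_zero]

theorem extEnvMap_add (i : ℕ) (f g : envBimodule k A ⟶ envBimodule k A) :
    extEnvMap k A i (f + g) = extEnvMap k A i f + extEnvMap k A i g := by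
  refine AddMonoidHom.ext fun (e : Abelian.Ext.{u} (regularBimodule k A) (envBimodule k A) i) => ?_
  change e.comp (Abelian.Ext.mk₀ (f + g)) (add_zero i) =
    e.comp (Abelian.Ext.mk₀ f) (add_zero i) + e.comp (Abelian.Ext.mk₀ g) (add_zero i)
  rw [Abelian.Ext.mk₀_add, Abelian.Ext.comp_add]

/-- The action of `Aᵉ` on `Ext^i_{Aᵉ}(A, Aᵉ)` which comes from functoriality and the inner bimodule
structure of `Aᵉ`: the element `a ⊗ b` acts as the map induced by right multiplication
by `b ⊗ a`, that is, by the endomorphism `c ⊗ d ↦ c b ⊗ a d` of `Aᵉ`. -/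
noncomputable def extEnvAction (i : ℕ) : EnvAlg k A →+* AddMonoid.End (ExtEnv k A i) where
  toFun w := extEnvMap k A i (envRightMul k A (envFlip k A w).unop)
  map_one' := by rw [map_one, MulOpposite.unop_one, envRightMul_one, extEnvMap_id]
  map_mul' w w' := by rw [map_mul, MulOpposite.unop_mul, envRightMul_mul, extEnvMap_comp]
  map_zero' := by rw [map_zero, MulOpposite.unop_zero, envRightMul_zero, extEnvMap_zero]
  map_add' w w' := by
    rw [map_add, MulOpposite.unop_add, envRightMul_add, extEnvMap_add]

noncomputable instance (i : ℕ) : Module (EnvAlg k A) (ExtEnv k A i) :=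
  Module.compHom (ExtEnv k A i) (extEnvAction k A i)

variable {k A}

/-- The bimodule `A_σ`: the vector space `A` with `a ▷ x ◁ b = a x σ(b)`. -/
def TwistedBimodule (_σ : A ≃ₐ[k] A) : Type u := A

noncomputable instance (σ : A ≃ₐ[k] A) : AddCommGroup (TwistedBimodule σ) :=
  inferInstanceAs (AddCommGroup A)

noncomputable instance (σ : A ≃ₐ[k] A) : Module (EnvAlg k A) (TwistedBimodule σ) :=
  letI : Module (EnvAlg k A) A := instModuleTensorProductMop k A
  Module.compHom A
    (Algebra.TensorProduct.map (AlgHom.id k A) (AlgHom.op (σ : A →ₐ[k] A))).toRingHom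

theorem twistedBimodule_smul (σ : A ≃ₐ[k] A) (a b x : A) :
    (a ⊗ₜ[k] op b) • (show TwistedBimodule σ from x)
      = (show TwistedBimodule σ from a * x * σ b) := by
  have h := AlgHom.mulLeftRight_apply k A a (op (σ b)) x
  simp only [unop_op] at h
  exact h

variable (k A)

/-- An algebra is twisted Calabi-Yau of dimension `d` with modular automorphism `σ`. -/
structure IsTwistedCalabiYau (d : ℕ) (σ : A ≃ₐ[k] A) : Prop where
  /-- `A` has a resolution of finite length by finitely generated projective bimodules. -/
  exists_resolution : ∃ P : ProjectiveResolution (regularBimodule k A),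
    (∀ n, Module.Finite (EnvAlg k A) (P.complex.X n)) ∧
    ∃ N : ℕ, ∀ n, N < n → Limits.IsZero (P.complex.X n)
  /-- `Ext^i_{Aᵉ}(A, Aᵉ)` vanishes for `i ≠ d`. -/
  ext_eq_zero : ∀ i : ℕ, i ≠ d → Subsingleton (ExtEnv k A i)
  /-- `Ext^d_{Aᵉ}(A, Aᵉ)` is isomorphic to `A_σ` as a bimodule. -/
  ext_iso : Nonempty (ExtEnv k A d ≃ₗ[EnvAlg k A] TwistedBimodule σ)

end Bimodules

/-! ### Line arrangements in the plane and their differential operators -/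

section Arrangements

variable (k : Type u) [Field k]

/-- A central arrangement of lines in the plane `k²`: a finite set of one-dimensional
subspaces. -/
structure CentralLineArrangement where
  lines : Finset (Submodule k (Fin 2 → k))
  finrank_eq_one : ∀ L ∈ lines, Module.finrank k L = 1

/-- The line in the plane with equation `x = 0`. -/
def lineXEqZero : Submodule k (Fin 2 → k) :=
  LinearMap.ker (LinearMap.proj (R := k) (φ := fun _ : Fin 2 => k) 0)

variable {k}

/-- `Q` is a defining polynomial of the arrangement: a product of linear forms, one for each
line and with that line as zero locus. -/
def CentralLineArrangement.IsDefiningPolynomial (𝒜 : CentralLineArrangement k)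
    (Q : MvPolynomial (Fin 2) k) : Prop :=
  ∃ α : Submodule k (Fin 2 → k) → MvPolynomial (Fin 2) k,
    (∀ L ∈ 𝒜.lines, (α L).IsHomogeneous 1 ∧ ∀ p : Fin 2 → k, p ∈ L ↔ eval p (α L) = 0) ∧
    Q = ∏ L ∈ 𝒜.lines, α L

theorem CentralLineArrangement.IsDefiningPolynomial.isHomogeneous
    {𝒜 : CentralLineArrangement k} {Q : MvPolynomial (Fin 2) k}
    (h : 𝒜.IsDefiningPolynomial Q) : Q.IsHomogeneous 𝒜.lines.card := by
  obtain ⟨α, hα, rfl⟩ := h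
  simpa using IsHomogeneous.prod 𝒜.lines α (fun _ => 1) (fun L hL => (hα L hL).1)

/-- The `S`-module of derivations `δ` of `S = k[x, y]` such that `δ(Q) ∈ Q S`. -/
def logDerivations (Q : MvPolynomial (Fin 2) k) :
    Submodule (MvPolynomial (Fin 2) k)
      (Derivation k (MvPolynomial (Fin 2) k) (MvPolynomial (Fin 2) k)) where
  carrier := {δ | Q ∣ δ Q}
  add_mem' h₁ h₂ := dvd_add h₁ h₂
  zero_mem' := dvd_zero Q
  smul_mem' f _ h := Dvd.dvd.mul_left h f

/-- The algebra of differential operators tangent to the arrangement with defining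
polynomial `Q`: the subalgebra of `End_k(S)` generated by the multiplications by elements
of `S` and by the logarithmic derivations. -/
noncomputable def tangentOperators (Q : MvPolynomial (Fin 2) k) :
    Subalgebra k (Module.End k (MvPolynomial (Fin 2) k)) :=
  Algebra.adjoin k
    (Set.range (fun f : MvPolynomial (Fin 2) k => LinearMap.mulLeft k f) ∪
      {T | ∃ δ ∈ logDerivations Q, T = (δ : MvPolynomial (Fin 2) k →ₗ[k] MvPolynomial (Fin 2) k)})

/-- A polynomial as an element of the algebra of tangent operators. -/
noncomputable def polyOperator (Q f : MvPolynomial (Fin 2) k) : tangentOperators Q :=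
  ⟨LinearMap.mulLeft k f, Algebra.subset_adjoin (Or.inl ⟨f, rfl⟩)⟩

/-- A logarithmic derivation as an element of the algebra of tangent operators. -/
noncomputable def derOperator (Q : MvPolynomial (Fin 2) k)
    (δ : Derivation k (MvPolynomial (Fin 2) k) (MvPolynomial (Fin 2) k))
    (hδ : δ ∈ logDerivations Q) : tangentOperators Q :=
  ⟨(δ : MvPolynomial (Fin 2) k →ₗ[k] MvPolynomial (Fin 2) k),
    Algebra.subset_adjoin (Or.inr ⟨δ, hδ, rfl⟩)⟩

variable (k) in
/-- The derivation `x ∂_x + y ∂_y`. -/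
noncomputable def derE : Derivation k (MvPolynomial (Fin 2) k) (MvPolynomial (Fin 2) k) :=
  (X 0 : MvPolynomial (Fin 2) k) • pderiv 0 + (X 1 : MvPolynomial (Fin 2) k) • pderiv 1

/-- The derivation `F ∂_y`. -/
noncomputable def derD (F : MvPolynomial (Fin 2) k) :
    Derivation k (MvPolynomial (Fin 2) k) (MvPolynomial (Fin 2) k) :=
  F • pderiv 1

theorem derE_mem {𝒜 : CentralLineArrangement k} {Q : MvPolynomial (Fin 2) k}
    (h : 𝒜.IsDefiningPolynomial Q) : derE k ∈ logDerivations Q := by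
  have h' := h.isHomogeneous.sum_X_mul_pderiv
  rw [Fin.sum_univ_two] at h'
  change Q ∣ X 0 * pderiv 0 Q + X 1 * pderiv 1 Q
  rw [h', nsmul_eq_mul]
  exact Dvd.intro_left _ rfl

theorem derD_mem (F : MvPolynomial (Fin 2) k) : derD F ∈ logDerivations (X 0 * F) := by
  refine ⟨pderiv 1 F, ?_⟩
  change F * pderiv 1 (X 0 * F) = _
  have h0 : pderiv (1 : Fin 2) (X 0 : MvPolynomial (Fin 2) k) = 0 :=
    pderiv_X_of_ne (by decide)
  rw [pderiv_mul, h0]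
  ring

end Arrangements

/-! ### Finite resolutions by finitely generated projectives, and short exact sequences. -/

section FiniteResolutions

variable {R : Type u} [Ring R]

/-! Write R for the enveloping algebra of A and a' = a ⊗ 1 - 1 ⊗ a. The logarithmic derivations are
spanned over S by E and D (`exists_eq_add`), so A is generated by x, y, D, E, with [D,x] = 0, [D,y]
= F, [E,x] = x, [E,y] = y, [E,D] = rD. Powers of each generator are independent over the subalgebra
B of the previous ones (`IsOreVariable.linearIndependent_pow`), so A is an iterated Ore extension
and is free as a left B-module.

The quotient of R by the left ideal I generated by the b', b in B, is A ⊗_B A. Freeness makes right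
multiplication by t', for the next generator t, injective on it (`mem_envIdeal_of_mul_envDiff_mem`),
and the cokernel is the next such quotient. Four of these short exact sequences lead from R to A.
Each one lengthens the resolution by one and shifts the only nonzero Ext group by one degree.

The Ext groups are tracked through the anti-automorphism θ(a ⊗ b) = σ⁻¹(b) ⊗ a: at each stage
Ext^i(R/I, R) is R modulo the right ideal matching I under θ. The step
`IsDualPresentation.exists_sup_span` needs the map induced by t' to be left multiplication by some
t* with θ(t*) ≡ -t' modulo I. Since θ(a ⊗ 1 - 1 ⊗ σ(a)) = -a', the discrepancy between t* and t' is
what σ records. It is computed by moving t' past the earlier generators: x and y need no correction;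
moving D' past y' costs G, a divided difference of F in y with diagonal value F_y; moving E' past
D', y', x' costs r + 1 + 1. At the end the quotient of R is A_σ, by a ⊗ b ↦ b σ(a).

The map σ itself is conjugation a ↦ Q⁻¹aQ (`conjHom`), which adds δ(Q)/Q to a logarithmic derivation
δ: this is F_y for D and r + 2 for E. -/

/-- The module `M` has a resolution of length less than `n` by finitely generated projective
modules. -/
def HasFiniteProjectiveResolution (R : Type u) [Ring R] : ℕ → ModuleCat.{u} R → Prop
  | 0, M => Subsingleton M
  | n + 1, M => ∃ (P : ModuleCat.{u} R) (f : P ⟶ M), Module.Projective R P ∧ Module.Finite R P ∧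
      Function.Surjective f.hom ∧
      HasFiniteProjectiveResolution R n (ModuleCat.of R (LinearMap.ker f.hom))

namespace HasFiniteProjectiveResolution

theorem of_linearEquiv {n : ℕ} {M N : ModuleCat.{u} R} (e : M ≃ₗ[R] N)
    (h : HasFiniteProjectiveResolution R n M) : HasFiniteProjectiveResolution R n N := by
  induction n generalizing M N with
  | zero =>
    change Subsingleton M at h
    exact e.symm.injective.subsingleton
  | succ n ih =>
    obtain ⟨P, f, hP, hfin, hf, hK⟩ := h
    refine ⟨P, ModuleCat.ofHom (e.toLinearMap ∘ₗ f.hom), hP, hfin, e.surjective.comp hf, ?_⟩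
    refine ih (LinearEquiv.ofEq _ _ ?_) hK
    ext x
    simp

theorem succ {n : ℕ} {M : ModuleCat.{u} R} (h : HasFiniteProjectiveResolution R n M) :
    HasFiniteProjectiveResolution R (n + 1) M := by
  induction n generalizing M with
  | zero =>
    change Subsingleton M at h
    refine ⟨ModuleCat.of R PUnit.{u + 1}, 0, inferInstanceAs (Module.Projective R PUnit.{u + 1}),
      inferInstanceAs (Module.Finite R PUnit.{u + 1}), fun m => ⟨0, Subsingleton.elim _ _⟩, ?_⟩
    change Subsingleton (LinearMap.ker (0 : PUnit.{u+1} →ₗ[R] M))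
    infer_instance
  | succ n ih =>
    obtain ⟨P, f, hP, hfin, hf, hK⟩ := h
    exact ⟨P, f, hP, hfin, hf, ih hK⟩

/-- Horseshoe lemma: the cover of Z lifts to Y, and together with the cover of X it covers Y; the
kernels again form a short exact sequence. -/
theorem of_exact {n : ℕ} {X Y Z : ModuleCat.{u} R} (i : X →ₗ[R] Y) (g : Y →ₗ[R] Z)
    (hi : Function.Injective i) (hg : Function.Surjective g) (hig : Function.Exact i g)
    (hX : HasFiniteProjectiveResolution R n X) (hZ : HasFiniteProjectiveResolution R n Z) :
    HasFiniteProjectiveResolution R n Y := by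
  induction n generalizing X Y Z with
  | zero =>
    change Subsingleton X at hX
    change Subsingleton Z at hZ
    change Subsingleton Y
    refine subsingleton_of_forall_eq 0 fun y => ?_
    obtain ⟨x, rfl⟩ := (hig y).1 (Subsingleton.elim _ _)
    rw [Subsingleton.elim x 0, map_zero]
  | succ n ih =>
    obtain ⟨P, f, hP, hfin, hf, hK⟩ := hX
    obtain ⟨P', f', hP', hfin', hf', hK'⟩ := hZ
    obtain ⟨l, hl⟩ := Module.projective_lifting_property g f'.hom hg
    have hl' : ∀ q, g (l q) = f'.hom q := fun q => LinearMap.congr_fun hl q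
    have hgi : ∀ x, g (i x) = 0 := fun x => (hig _).2 ⟨x, rfl⟩
    let φ : (P × P') →ₗ[R] Y := (i ∘ₗ f.hom).coprod l
    have hφ : ∀ p q, φ (p, q) = i (f.hom p) + l q := fun p q => rfl
    refine ⟨ModuleCat.of R (P × P'), ModuleCat.ofHom φ,
      inferInstanceAs (Module.Projective R (P × P')),
      inferInstanceAs (Module.Finite R (P × P')), ?_, ?_⟩
    · intro y
      obtain ⟨q, hq⟩ := hf' (g y)
      obtain ⟨x, hx⟩ := (hig (y - l q)).1 (by rw [map_sub, hl', hq, sub_self])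
      obtain ⟨p, rfl⟩ := hf x
      exact ⟨(p, q), by change φ (p, q) = y; rw [hφ, hx, sub_add_cancel]⟩
    · let j : LinearMap.ker f.hom →ₗ[R] LinearMap.ker φ :=
        LinearMap.codRestrict _ (LinearMap.inl R P P' ∘ₗ Submodule.subtype _) fun p => by
          change φ (p.1, 0) = 0
          rw [hφ, p.2, map_zero, map_zero, add_zero]
      let k : LinearMap.ker φ →ₗ[R] LinearMap.ker f'.hom :=
        LinearMap.codRestrict _ (LinearMap.snd R P P' ∘ₗ Submodule.subtype _) fun p => by
          obtain ⟨⟨p, q⟩, hp⟩ := p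
          change f'.hom q = 0
          have hp : i (f.hom p) + l q = 0 := hp
          have := congrArg g hp
          rwa [map_add, hgi, zero_add, hl', map_zero] at this
      refine ih (X := ModuleCat.of R _) (Z := ModuleCat.of R _) j k ?_ ?_ ?_ hK hK'
      · intro p q h
        exact Subtype.ext (congrArg (fun z => z.1.1) h)
      · intro q
        -- The lift `l q` dies in Z, so it comes from X and is cancelled by an element of P.
        obtain ⟨x, hx⟩ := (hig (l q.1)).1 (by rw [hl', q.2])
        obtain ⟨p, hp⟩ := hf (-x)
        exact ⟨⟨(p, q.1), by change φ (p, q.1) = 0; rw [hφ, hp, map_neg, hx, neg_add_cancel]⟩,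
          rfl⟩
      · rintro ⟨⟨p, q⟩, hp⟩
        constructor
        · intro h
          have hq : q = 0 := congrArg Subtype.val h
          subst hq
          refine ⟨⟨p, hi ?_⟩, rfl⟩
          have hp : i (f.hom p) + l 0 = 0 := hp
          rwa [map_zero, add_zero, ← map_zero i] at hp
        · rintro ⟨z, hz⟩
          exact Subtype.ext (congrArg (fun z => z.1.2) hz).symm

/-- The cover P of Y also covers Z, and the kernel of P → Z is an extension of X by the kernel of P
→ Y, so `of_exact` applies to it. -/
theorem of_exact_right {n : ℕ} {X Y Z : ModuleCat.{u} R} (i : X →ₗ[R] Y) (g : Y →ₗ[R] Z)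
    (hi : Function.Injective i) (hg : Function.Surjective g) (hig : Function.Exact i g)
    (hX : HasFiniteProjectiveResolution R n X) (hY : HasFiniteProjectiveResolution R n Y) :
    HasFiniteProjectiveResolution R (n + 1) Z := by
  cases n with
  | zero =>
    change Subsingleton Y at hY
    exact succ (n := 0) hg.subsingleton
  | succ n =>
    obtain ⟨P, f, hP, hfin, hf, hK⟩ := hY
    refine ⟨P, ModuleCat.ofHom (g ∘ₗ f.hom), hP, hfin, hg.comp hf, ?_⟩
    let e : X ≃ₗ[R] LinearMap.range i := LinearEquiv.ofInjective i hi
    have hrange : ∀ p : LinearMap.ker (g ∘ₗ f.hom), f.hom p.1 ∈ LinearMap.range i :=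
      fun p => (hig _).1 p.2
    let π : LinearMap.ker (g ∘ₗ f.hom) →ₗ[R] LinearMap.range i :=
      LinearMap.codRestrict _ (f.hom ∘ₗ Submodule.subtype _) hrange
    let j : LinearMap.ker f.hom →ₗ[R] LinearMap.ker (g ∘ₗ f.hom) :=
      Submodule.inclusion fun p hp => by
        change g (f.hom p) = 0
        rw [hp, map_zero]
    -- The resolution `hK` of the kernel is one step shorter than that of X; `succ` pads it to the
    -- same bound.
    refine of_exact (X := ModuleCat.of R _) (Y := ModuleCat.of R _)
      (Z := ModuleCat.of R (LinearMap.range i)) j π ?_ ?_ ?_ (succ hK) (of_linearEquiv e hX)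
    · exact Submodule.inclusion_injective _
    · rintro ⟨y, x, rfl⟩
      obtain ⟨p, hp⟩ := hf (i x)
      refine ⟨⟨p, ?_⟩, Subtype.ext hp⟩
      change g (f.hom p) = 0
      rw [hp]
      exact (hig _).2 ⟨x, rfl⟩
    · rintro ⟨p, hp⟩
      constructor
      · intro h
        exact ⟨⟨p, congrArg Subtype.val h⟩, rfl⟩
      · rintro ⟨z, hz⟩
        have : z.1 = p := congrArg Subtype.val hz
        subst this
        exact Subtype.ext z.2

theorem of_projective (M : ModuleCat.{u} R) [Module.Projective R M] [Module.Finite R M] :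
    HasFiniteProjectiveResolution R 1 M := by
  refine ⟨M, 𝟙 M, inferInstance, inferInstance, fun m => ⟨m, rfl⟩, ?_⟩
  change Subsingleton (LinearMap.ker (LinearMap.id : M →ₗ[R] M))
  rw [LinearMap.ker_id]
  infer_instance

end HasFiniteProjectiveResolution

end FiniteResolutions
-- Passage to projective resolutions as chain complexes.
section ProjectiveResolutions

open Limits

/-- A projective resolution of `X₃` from one of `X₁` and a short exact sequence whose middle
term is projective. -/
theorem exists_projectiveResolution_augment {C : Type*} [Category* C] [Abelian C]
    {S : ShortComplex C} (hS : S.ShortExact) [Projective S.X₂] (Q : ProjectiveResolution S.X₁) :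
    ∃ P : ProjectiveResolution S.X₃,
      P.complex.X 0 = S.X₂ ∧ ∀ n, P.complex.X (n + 1) = Q.complex.X n := by
  have := hS.mono_f
  have := hS.epi_g
  let q : Q.complex.X 0 ⟶ S.X₁ := Q.π.f 0
  have hq : Q.complex.d 1 0 ≫ q = 0 := Q.complex_d_comp_π_f_zero
  have hw : Q.complex.d 1 0 ≫ (q ≫ S.f) = 0 := by rw [← Category.assoc, hq, zero_comp]
  let K : ChainComplex C ℕ := Q.complex.augment (q ≫ S.f) hw
  have hd : K.d 1 0 = q ≫ S.f := rfl
  have hdg : K.d 1 0 ≫ S.g = 0 := by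
    change (q ≫ S.f) ≫ S.g = 0
    rw [Category.assoc, S.zero, comp_zero]
  have hex0 : (ShortComplex.mk (K.d 1 0) S.g hdg).Exact := by
    -- Replacing the left map by its composite with the epimorphism `q` does not change its image.
    let φ : ShortComplex.mk (K.d 1 0) S.g hdg ⟶ S :=
      { τ₁ := q
        τ₂ := 𝟙 _
        τ₃ := 𝟙 _
        comm₁₂ := (Category.comp_id (q ≫ S.f)).symm
        comm₂₃ := (Category.id_comp S.g).trans (Category.comp_id S.g).symm }
    have : Epi φ.τ₁ := inferInstanceAs (Epi (Q.π.f 0))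
    have : IsIso φ.τ₂ := inferInstanceAs (IsIso (𝟙 _))
    have : Mono φ.τ₃ := inferInstanceAs (Mono (𝟙 _))
    exact (ShortComplex.exact_iff_of_epi_of_isIso_of_mono φ).2 hS.exact
  have hex1 : (ShortComplex.mk (K.d 2 1) (K.d 1 0) (K.d_comp_d 2 1 0)).Exact := by
    -- Composing the augmentation of `Q` with the monomorphism `S.f` does not change its kernel.
    let φ : ShortComplex.mk _ _ Q.complex_d_comp_π_f_zero ⟶
        ShortComplex.mk (K.d 2 1) (K.d 1 0) (K.d_comp_d 2 1 0) :=
      { τ₁ := 𝟙 _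
        τ₂ := 𝟙 _
        τ₃ := S.f
        comm₁₂ := (Category.id_comp _).trans (Category.comp_id _).symm
        comm₂₃ := Category.id_comp _ }
    have : Epi φ.τ₁ := inferInstanceAs (Epi (𝟙 _))
    have : IsIso φ.τ₂ := inferInstanceAs (IsIso (𝟙 _))
    have : Mono φ.τ₃ := inferInstanceAs (Mono S.f)
    exact (ShortComplex.exact_iff_of_epi_of_isIso_of_mono φ).1 Q.exact₀
  have hexK : ∀ n, K.ExactAt (n + 1) := by
    intro n
    rw [HomologicalComplex.exactAt_iff' _ (n + 1 + 1) (n + 1) n (by simp) (by simp)]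
    cases n with
    | zero => exact hex1
    | succ n => exact Q.exact_succ n
  have hπ : ((ChainComplex.toSingle₀Equiv K S.X₃).symm ⟨S.g, hdg⟩).f 0 = S.g :=
    ChainComplex.toSingle₀Equiv_symm_apply_f_zero _ _
  refine ⟨{ complex := K
            projective := fun n => ?_
            π := (ChainComplex.toSingle₀Equiv _ _).symm ⟨S.g, hdg⟩
            quasiIso := ⟨fun n => ?_⟩ }, rfl, fun n => rfl⟩
  · cases n with
    | zero => exact inferInstanceAs (Projective S.X₂)
    | succ n => exact Q.projective n
  · cases n with
    | zero =>
      rw [ChainComplex.quasiIsoAt₀_iff, ShortComplex.quasiIso_iff_of_zeros']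
      · refine (ShortComplex.exact_and_epi_g_iff_of_iso ?_).2 ⟨hex0, hS.epi_g⟩
        exact ShortComplex.isoMk (Iso.refl _) (Iso.refl _) (Iso.refl _)
          ((Category.id_comp _).trans (Category.comp_id _).symm)
          ((Category.id_comp S.g).trans (hπ.symm.trans (Category.comp_id _).symm))
      all_goals rfl
    | succ n =>
      rw [quasiIsoAt_iff_exactAt']
      · exact hexK n
      · apply ChainComplex.exactAt_succ_single_obj

theorem HasFiniteProjectiveResolution.exists_projectiveResolution {R : Type u} [Ring R] {n : ℕ}
    {M : ModuleCat.{u} R} (h : HasFiniteProjectiveResolution R n M) :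
    ∃ P : ProjectiveResolution M, (∀ i, Module.Finite R (P.complex.X i)) ∧
      ∃ N : ℕ, ∀ i, N < i → IsZero (P.complex.X i) := by
  induction n generalizing M with
  | zero =>
    change Subsingleton M at h
    have hM : IsZero M := ModuleCat.isZero_of_subsingleton M
    have : Projective M := hM.projective
    have hz : ∀ i, IsZero ((ProjectiveResolution.self M).complex.X i) := by
      intro i
      cases i with
      | zero => exact hM
      | succ i => exact HomologicalComplex.isZero_single_obj_X _ _ _ _ (by simp)
    refine ⟨ProjectiveResolution.self M, fun i => ?_, 0, fun i _ => hz i⟩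
    have := ModuleCat.subsingleton_of_isZero (hz i)
    infer_instance
  | succ n ih =>
    obtain ⟨P, f, hP, hfin, hf, hK⟩ := h
    obtain ⟨Q, hQ, N, hN⟩ := ih hK
    let S : ShortComplex (ModuleCat.{u} R) :=
      ShortComplex.mk (ModuleCat.ofHom (LinearMap.ker f.hom).subtype) f (by ext x; exact x.2)
    have hS : S.ShortExact :=
      { exact := by
          rw [ShortComplex.moduleCat_exact_iff]
          intro x hx
          exact ⟨⟨x, hx⟩, rfl⟩
        mono_f := (ModuleCat.mono_iff_injective _).2 Subtype.val_injective
        epi_g := (ModuleCat.epi_iff_surjective _).2 hf }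
    have : Projective S.X₂ := (IsProjective.iff_projective P).1 hP
    obtain ⟨T, hT0, hT⟩ := exists_projectiveResolution_augment hS Q
    refine ⟨T, fun i => ?_, N + 1, fun i hi => ?_⟩
    · cases i with
      | zero => rw [hT0]; exact hfin
      | succ i => rw [hT]; exact hQ i
    · obtain ⟨j, rfl⟩ := Nat.exists_eq_succ_of_ne_zero (Nat.ne_of_gt (Nat.zero_lt_of_lt hi))
      rw [hT]
      exact hN j (by omega)

end ProjectiveResolutions
-- Cyclic modules R/I and the inductive computation of Ext(R/I, R).
section CyclicModules

variable {R : Type u} [Ring R]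

/-- Right multiplication by `s` on the cyclic module `R ⧸ I`, for `s` in the idealizer of `I`. -/
def quotientRightMul (I : Submodule R R) (s : R) (hs : ∀ z ∈ I, z * s ∈ I) :
    (R ⧸ I) →ₗ[R] (R ⧸ I) :=
  Submodule.mapQ I I (LinearMap.toSpanSingleton R R s) hs

theorem quotientRightMul_mk {I : Submodule R R} {s : R} (hs : ∀ z ∈ I, z * s ∈ I) (z : R) :
    quotientRightMul I s hs (Submodule.Quotient.mk z) = Submodule.Quotient.mk (z * s) := rfl

theorem mul_mem_sup_span {I : Submodule R R} {t s s₀ : R} (hs : ∀ z ∈ I, z * s ∈ I)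
    (h : t * s - s₀ * t ∈ I) : ∀ z ∈ I ⊔ Submodule.span R {t}, z * s ∈ I ⊔ Submodule.span R {t} := by
  intro z hz
  obtain ⟨a, ha, b, hb, rfl⟩ := Submodule.mem_sup.1 hz
  obtain ⟨c, rfl⟩ := Submodule.mem_span_singleton.1 hb
  have : (a + c • t) * s = (a * s + c • (t * s - s₀ * t)) + (c * s₀) • t := by
    simp only [smul_eq_mul]
    noncomm_ring
  rw [this]
  exact Submodule.add_mem_sup (I.add_mem (hs a ha) (I.smul_mem c h))
    (Submodule.smul_mem _ _ (Submodule.mem_span_singleton_self t))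

/-- The sequence `R ⧸ I → R ⧸ I → R ⧸ (I + R t)` given by right multiplication by `t`. -/
abbrev rightMulSequence (I : Submodule R R) (t : R) (ht : ∀ z ∈ I, z * t ∈ I) :
    ShortComplex (ModuleCat.{u} R) :=
  ShortComplex.mk (X₁ := ModuleCat.of R (R ⧸ I)) (X₂ := ModuleCat.of R (R ⧸ I))
    (X₃ := ModuleCat.of R (R ⧸ (I ⊔ Submodule.span R {t})))
    (ModuleCat.ofHom (quotientRightMul I t ht))
    (ModuleCat.ofHom (Submodule.factor le_sup_left)) (by
      refine ModuleCat.hom_ext (LinearMap.ext fun z => ?_)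
      obtain ⟨z, rfl⟩ := Submodule.Quotient.mk_surjective _ z
      change Submodule.Quotient.mk (z * t) = 0
      rw [Submodule.Quotient.mk_eq_zero]
      exact Submodule.mem_sup_right (Submodule.smul_mem _ z (Submodule.mem_span_singleton_self t)))

theorem quotientRightMul_injective {I : Submodule R R} {t : R} (ht : ∀ z ∈ I, z * t ∈ I)
    (hinj : ∀ z, z * t ∈ I → z ∈ I) : Function.Injective (quotientRightMul I t ht) := by
  rw [injective_iff_map_eq_zero]
  intro z hz
  obtain ⟨z, rfl⟩ := Submodule.Quotient.mk_surjective _ z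
  rw [quotientRightMul_mk, Submodule.Quotient.mk_eq_zero] at hz
  exact (Submodule.Quotient.mk_eq_zero _).2 (hinj z hz)

theorem quotientRightMul_exact {I : Submodule R R} {t : R} (ht : ∀ z ∈ I, z * t ∈ I) :
    Function.Exact (quotientRightMul I t ht)
      (Submodule.factor (le_sup_left : I ≤ I ⊔ Submodule.span R {t})) := by
  intro z
  obtain ⟨z, rfl⟩ := Submodule.Quotient.mk_surjective _ z
  change (Submodule.Quotient.mk z : R ⧸ (I ⊔ Submodule.span R {t})) = 0 ↔ _
  rw [Submodule.Quotient.mk_eq_zero]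
  constructor
  · intro hz
    obtain ⟨a, ha, b, hb, rfl⟩ := Submodule.mem_sup.1 hz
    obtain ⟨c, rfl⟩ := Submodule.mem_span_singleton.1 hb
    refine ⟨Submodule.Quotient.mk c, ?_⟩
    rw [quotientRightMul_mk, eq_comm, Submodule.Quotient.eq]
    simpa using ha
  · rintro ⟨c, hc⟩
    obtain ⟨c, rfl⟩ := Submodule.Quotient.mk_surjective _ c
    rw [quotientRightMul_mk, eq_comm, Submodule.Quotient.eq] at hc
    rw [← sub_add_cancel z (c * t)]
    exact Submodule.add_mem_sup hc
      (Submodule.smul_mem _ c (Submodule.mem_span_singleton_self t))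

theorem rightMulSequence_shortExact {I : Submodule R R} {t : R} (ht : ∀ z ∈ I, z * t ∈ I)
    (hinj : ∀ z, z * t ∈ I → z ∈ I) : (rightMulSequence I t ht).ShortExact where
  exact := (ShortComplex.ShortExact.moduleCat_exact_iff_function_exact _).2 (quotientRightMul_exact ht)
  mono_f := (ModuleCat.mono_iff_injective _).2 (quotientRightMul_injective ht hinj)
  epi_g := (ModuleCat.epi_iff_surjective _).2 (Submodule.factor_surjective le_sup_left)

/-- Both left terms of the sequence R/I → R/I → R/(I + Rt) are the same module, so a bound for R/I
is enough. -/
theorem HasFiniteProjectiveResolution.sup_span {n : ℕ} {I : Submodule R R} {t : R}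
    (ht : ∀ z ∈ I, z * t ∈ I) (hinj : ∀ z, z * t ∈ I → z ∈ I)
    (h : HasFiniteProjectiveResolution R n (ModuleCat.of R (R ⧸ I))) :
    HasFiniteProjectiveResolution R (n + 1)
      (ModuleCat.of R (R ⧸ (I ⊔ Submodule.span R {t}))) :=
  of_exact_right (X := ModuleCat.of R (R ⧸ I)) (Y := ModuleCat.of R (R ⧸ I)) _ _
    (quotientRightMul_injective ht hinj) (Submodule.factor_surjective _)
    (quotientRightMul_exact ht) h h

/-- `Ext^i(R ⧸ I, R)`. -/
abbrev CyclicExt (I : Submodule R R) (i : ℕ) : Type u :=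
  Abelian.Ext.{u} (ModuleCat.of R (R ⧸ I)) (ModuleCat.of R R) i

/-- Right multiplication by `w`, as an endomorphism of the left module `R`. -/
def rightMulHom (w : R) : ModuleCat.of R R ⟶ ModuleCat.of R R :=
  ModuleCat.ofHom (LinearMap.toSpanSingleton R R w)

/-- The groups `Ext^j(R ⧸ I, R)` vanish for `j ≠ i`, and `ρ` presents `Ext^i(R ⧸ I, R)` as the
quotient of the right module `R` by the right ideal which corresponds to `I` under the
anti-automorphism `θ`. -/
structure IsDualPresentation (θ : R ≃+* Rᵐᵒᵖ) (I : Submodule R R) (i : ℕ)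
    (ρ : R →+ CyclicExt I i) : Prop where
  surjective : Function.Surjective ρ
  eq_zero_iff : ∀ z, ρ z = 0 ↔ (θ z).unop ∈ I
  apply_mul : ∀ z w, ρ (z * w) = (ρ z).comp (Abelian.Ext.mk₀ (rightMulHom w)) (add_zero i)
  subsingleton : ∀ j, j ≠ i → Subsingleton (CyclicExt I j)

/-- The endomorphism of `Ext^i(R ⧸ I, R)` induced by right multiplication by `s` on `R ⧸ I` is
left multiplication by `s'` in the presentation `ρ`. -/
def IsTranspose {I : Submodule R R} {i : ℕ} (ρ : R →+ CyclicExt I i) (s : R)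
    (hs : ∀ z ∈ I, z * s ∈ I) (s' : R) : Prop :=
  ∀ z, (Abelian.Ext.mk₀ (ModuleCat.ofHom (quotientRightMul I s hs))).comp (ρ z) (zero_add i) =
    ρ (s' * z)

/-- If θ(t'z) = θ(z)θ(t') lies in I, then so does θ(z)t, because θ(t') ≡ -t modulo I; injectivity of
right multiplication by t then puts θ(z) in I. -/
theorem IsDualPresentation.transpose_injective {θ : R ≃+* Rᵐᵒᵖ} {I : Submodule R R} {i : ℕ}
    {ρ : R →+ CyclicExt I i} (hρ : IsDualPresentation θ I i ρ) {t t' : R}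
    {ht : ∀ z ∈ I, z * t ∈ I} (hinj : ∀ z, z * t ∈ I → z ∈ I) (htt' : IsTranspose ρ t ht t')
    (hθ : (θ t').unop + t ∈ I) (x : CyclicExt I i)
    (hx : (Abelian.Ext.mk₀ (ModuleCat.ofHom (quotientRightMul I t ht))).comp x (zero_add i) = 0) :
    x = 0 := by
  obtain ⟨z, rfl⟩ := hρ.surjective x
  rw [htt', hρ.eq_zero_iff, map_mul, MulOpposite.unop_mul] at hx
  rw [hρ.eq_zero_iff]
  apply hinj
  have : (θ z).unop * t = (θ z).unop • ((θ t').unop + t) - (θ z).unop * (θ t').unop := by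
    rw [smul_eq_mul, mul_add, add_sub_cancel_left]
  rw [this]
  exact I.sub_mem (I.smul_mem _ hθ) hx

/-- In the long exact sequence the map induced by t is injective on Ext^i, so only its cokernel
survives, in degree i + 1. That cokernel is presented by adding t'R to the old right ideal, and θ
turns this into adding Rt to I. The last clause is naturality of the connecting map: an endomorphism
of the sequence acting by s on the quotient and s₀ on the submodule passes the transpose of s₀ on to
s. -/
theorem IsDualPresentation.exists_sup_span {θ : R ≃+* Rᵐᵒᵖ} {I : Submodule R R} {i : ℕ}
    {ρ : R →+ CyclicExt I i} (hρ : IsDualPresentation θ I i ρ) {t t' : R}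
    (ht : ∀ z ∈ I, z * t ∈ I) (hinj : ∀ z, z * t ∈ I → z ∈ I) (htt' : IsTranspose ρ t ht t')
    (hθ : (θ t').unop + t ∈ I) :
    ∃ ρ' : R →+ CyclicExt (I ⊔ Submodule.span R {t}) (i + 1),
      IsDualPresentation θ (I ⊔ Submodule.span R {t}) (i + 1) ρ' ∧
      ∀ (s s₀ s' : R) (hs : ∀ z ∈ I, z * s ∈ I) (hs₀ : ∀ z ∈ I, z * s₀ ∈ I)
        (h : t * s - s₀ * t ∈ I), IsTranspose ρ s₀ hs₀ s' →
        IsTranspose ρ' s (mul_mem_sup_span hs h) s' := by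
  have hS := rightMulSequence_shortExact ht hinj
  -- Pullback along the projection vanishes outside degree i + 1: in degree i its image is killed by
  -- the injective transpose of t, and elsewhere its target is zero.
  have hg : ∀ (j : ℕ), j ≠ i + 1 → ∀ x : CyclicExt (I ⊔ Submodule.span R {t}) j,
      (Abelian.Ext.mk₀ (rightMulSequence I t ht).g).comp x (zero_add j) = 0 := by
    intro j hj x
    by_cases hji : j = i
    · subst hji
      apply hρ.transpose_injective hinj htt' hθ
      change (Abelian.Ext.mk₀ (rightMulSequence I t ht).f).comp _ _ = 0
      rw [Abelian.Ext.mk₀_comp_mk₀_assoc, ShortComplex.zero, Abelian.Ext.mk₀_zero,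
        Abelian.Ext.zero_comp]
    · have := hρ.subsingleton j hji
      exact Subsingleton.elim (α := CyclicExt I j) _ _
  -- The new presentation is the old one followed by the connecting homomorphism.
  refine ⟨AddMonoidHom.comp (hS.extClass.precomp (ModuleCat.of R R) (add_comm 1 i)) ρ,
    ⟨?_, ?_, ?_, ?_⟩, ?_⟩
  · intro x
    have := hρ.subsingleton (i + 1) (by omega)
    obtain ⟨y, hy⟩ := Abelian.Ext.contravariant_sequence_exact₃ hS (ModuleCat.of R R) x
      (Subsingleton.elim (α := CyclicExt I (i + 1)) _ _) (add_comm 1 i)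
    obtain ⟨z, rfl⟩ := hρ.surjective y
    exact ⟨z, hy⟩
  · intro z
    constructor
    · intro hz
      obtain ⟨x, hx⟩ := Abelian.Ext.contravariant_sequence_exact₁ hS (ModuleCat.of R R) (ρ z)
        (add_comm 1 i) hz
      obtain ⟨w, rfl⟩ := hρ.surjective x
      have hzw : ρ (z - t' * w) = 0 := by
        rw [map_sub, ← htt' w, sub_eq_zero]
        exact hx.symm
      rw [hρ.eq_zero_iff, map_sub, map_mul, MulOpposite.unop_sub, MulOpposite.unop_mul] at hzw
      have : (θ z).unop = (((θ z).unop - (θ w).unop * (θ t').unop) +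
          (θ w).unop • ((θ t').unop + t)) + (-(θ w).unop) • t := by
        simp only [smul_eq_mul]
        noncomm_ring
      rw [this]
      exact Submodule.add_mem_sup (I.add_mem hzw (I.smul_mem _ hθ))
        (Submodule.smul_mem _ _ (Submodule.mem_span_singleton_self t))
    · intro hz
      obtain ⟨a, ha, b, hb, hab⟩ := Submodule.mem_sup.1 hz
      obtain ⟨c, rfl⟩ := Submodule.mem_span_singleton.1 hb
      -- The witness -θ⁻¹(c) works because ct ≡ -cθ(t') modulo I.
      have hw : (θ (-θ.symm (MulOpposite.op c))).unop = -c := by simp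
      have hzw : ρ (z - t' * (-θ.symm (MulOpposite.op c))) = 0 := by
        rw [hρ.eq_zero_iff, map_sub, map_mul, MulOpposite.unop_sub, MulOpposite.unop_mul, hw,
          ← hab]
        have : a + c • t - -c * (θ t').unop = a + c • ((θ t').unop + t) := by
          simp only [smul_eq_mul]
          noncomm_ring
        rw [this]
        exact I.add_mem ha (I.smul_mem _ hθ)
      rw [map_sub, sub_eq_zero, ← htt'] at hzw
      change hS.extClass.comp (ρ z) (add_comm 1 i) = 0
      rw [hzw]
      exact hS.extClass_comp_assoc _
  · intro z w
    change hS.extClass.comp (ρ (z * w)) (add_comm 1 i) = _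
    rw [hρ.apply_mul]
    exact (Abelian.Ext.comp_assoc_of_third_deg_zero _ _ _ _).symm
  · intro j hj
    refine subsingleton_of_forall_eq 0 fun x => ?_
    cases j with
    | zero =>
      have := hS.epi_g
      apply Abelian.Ext.precomp_mk₀_injective_of_epi (ModuleCat.of R R) (rightMulSequence I t ht).g
      rw [map_zero]
      exact hg 0 hj x
    | succ j =>
      obtain ⟨y, hy⟩ := Abelian.Ext.contravariant_sequence_exact₃ hS (ModuleCat.of R R) x
        (hg (j + 1) hj x) (add_comm 1 j)
      have := hρ.subsingleton j (by omega)
      rw [← hy, Subsingleton.elim (α := CyclicExt I j) y 0, Abelian.Ext.comp_zero]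
  · intro s s₀ s' hs hs₀ h hss' z
    let φ : rightMulSequence I t ht ⟶ rightMulSequence I t ht :=
      { τ₁ := ModuleCat.ofHom (quotientRightMul I s₀ hs₀)
        τ₂ := ModuleCat.ofHom (quotientRightMul I s hs)
        τ₃ := ModuleCat.ofHom (quotientRightMul _ s (mul_mem_sup_span hs h))
        comm₁₂ := by
          refine ModuleCat.hom_ext (LinearMap.ext fun z => ?_)
          obtain ⟨z, rfl⟩ := Submodule.Quotient.mk_surjective _ z
          change (Submodule.Quotient.mk (z * s₀ * t) : R ⧸ I) = Submodule.Quotient.mk (z * t * s)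
          rw [eq_comm, Submodule.Quotient.eq, mul_assoc, mul_assoc, ← mul_sub]
          exact I.smul_mem z h
        comm₂₃ := by
          refine ModuleCat.hom_ext (LinearMap.ext fun z => ?_)
          obtain ⟨z, rfl⟩ := Submodule.Quotient.mk_surjective _ z
          rfl }
    have hnat := ShortComplex.ShortExact.extClass_naturality hS hS φ
    change (Abelian.Ext.mk₀ φ.τ₃).comp (hS.extClass.comp (ρ z) (add_comm 1 i)) _ =
      hS.extClass.comp (ρ (s' * z)) (add_comm 1 i)
    rw [← hss' z, ← Abelian.Ext.comp_assoc (a₁₂ := 1) _ _ _ (zero_add 1) (add_comm 1 i) (Nat.add_comm _ _),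
      ← hnat]
    exact Abelian.Ext.comp_assoc_of_second_deg_zero _ _ _ _

/-- Homomorphisms from `R ⧸ ⊥` to `R` are right multiplications. -/
theorem exists_isDualPresentation_of_eq_bot (θ : R ≃+* Rᵐᵒᵖ) {I : Submodule R R} (hI : I = ⊥) :
    ∃ ρ : R →+ CyclicExt I 0, IsDualPresentation θ I 0 ρ ∧
      ∀ (s : R) (hs : ∀ z ∈ I, z * s ∈ I), IsTranspose ρ s hs s := by
  subst hI
  let e : ((R ⧸ (⊥ : Submodule R R)) ≃ₗ[R] R) := Submodule.quotEquivOfEqBot ⊥ rfl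
  have he : ∀ z, e (Submodule.Quotient.mk z) = z := fun z => rfl
  let η (z : R) : ModuleCat.of R (R ⧸ (⊥ : Submodule R R)) ⟶ ModuleCat.of R R :=
    ModuleCat.ofHom (LinearMap.toSpanSingleton R R z ∘ₗ e.toLinearMap)
  have hη : ∀ z w, (η z).hom (Submodule.Quotient.mk w) = w * z := fun z w => rfl
  have hadd : ∀ z w, η (z + w) = η z + η w := by
    intro z w
    refine ModuleCat.hom_ext (LinearMap.ext fun v => ?_)
    obtain ⟨v, rfl⟩ := Submodule.Quotient.mk_surjective _ v
    exact mul_add v z w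
  let ρ : R →+ CyclicExt (⊥ : Submodule R R) 0 :=
    AddMonoidHom.mk' (fun z => Abelian.Ext.mk₀ (η z)) fun z w => by
      rw [hadd, Abelian.Ext.mk₀_add]
  -- Projectivity gives the vanishing in positive degrees.
  have : Projective (ModuleCat.of R (R ⧸ (⊥ : Submodule R R))) :=
    (IsProjective.iff_projective _).1 (Module.Projective.of_equiv e.symm)
  refine ⟨ρ, ⟨?_, ?_, ?_, ?_⟩, ?_⟩
  · intro x
    obtain ⟨f, rfl⟩ := (Abelian.Ext.mk₀_bijective _ _).2 x
    refine ⟨f.hom (Submodule.Quotient.mk 1), congrArg Abelian.Ext.mk₀ ?_⟩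
    refine ModuleCat.hom_ext (LinearMap.ext fun v => ?_)
    obtain ⟨v, rfl⟩ := Submodule.Quotient.mk_surjective _ v
    rw [hη, ← smul_eq_mul, ← map_smul, ← Submodule.Quotient.mk_smul, smul_eq_mul, mul_one]
  · intro z
    change Abelian.Ext.mk₀ (η z) = 0 ↔ _
    rw [Abelian.Ext.mk₀_eq_zero_iff, Submodule.mem_bot, MulOpposite.unop_eq_zero_iff,
      map_eq_zero_iff θ θ.injective]
    constructor
    · intro h
      have := hη z 1
      rw [h, one_mul] at this
      exact this.symm
    · rintro rfl
      refine ModuleCat.hom_ext (LinearMap.ext fun v => ?_)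
      obtain ⟨v, rfl⟩ := Submodule.Quotient.mk_surjective _ v
      exact mul_zero v
  · intro z w
    change Abelian.Ext.mk₀ (η (z * w)) = (Abelian.Ext.mk₀ (η z)).comp _ _
    rw [Abelian.Ext.mk₀_comp_mk₀]
    congr 1
    refine ModuleCat.hom_ext (LinearMap.ext fun v => ?_)
    obtain ⟨v, rfl⟩ := Submodule.Quotient.mk_surjective _ v
    exact (mul_assoc v z w).symm
  · intro j hj
    obtain ⟨j, rfl⟩ := Nat.exists_eq_succ_of_ne_zero hj
    exact Abelian.Ext.subsingleton_of_projective _ _ _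
  · intro s hs z
    change (Abelian.Ext.mk₀ _).comp (Abelian.Ext.mk₀ (η z)) _ = Abelian.Ext.mk₀ (η (s * z))
    rw [Abelian.Ext.mk₀_comp_mk₀]
    congr 1
    refine ModuleCat.hom_ext (LinearMap.ext fun v => ?_)
    obtain ⟨v, rfl⟩ := Submodule.Quotient.mk_surjective _ v
    exact mul_assoc v s z

end CyclicModules
-- Iterated Ore extensions: independence of powers and bases.
section OrePowers

variable {k : Type v} [Field k] {A : Type u} [Ring A] [Algebra k A]

theorem commutator_mem_adjoin {s : Set A} {t : A}
    (h : ∀ b ∈ s, t * b - b * t ∈ Algebra.adjoin k s) :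
    ∀ b ∈ Algebra.adjoin k s, t * b - b * t ∈ Algebra.adjoin k s := by
  intro b hb
  induction hb using Algebra.adjoin_induction with
  | mem b hb => exact h b hb
  | algebraMap c =>
    rw [Algebra.commutes, sub_self]
    exact zero_mem _
  | add a b _ _ ha hb =>
    have : t * (a + b) - (a + b) * t = (t * a - a * t) + (t * b - b * t) := by noncomm_ring
    rw [this]
    exact add_mem ha hb
  | mul a b ha' hb' ha hb =>
    have : t * (a * b) - (a * b) * t = (t * a - a * t) * b + a * (t * b - b * t) := by
      noncomm_ring
    rw [this]
    exact add_mem (mul_mem ha hb') (mul_mem ha' hb)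

/-- The left `B`-module spanned by the powers of `t` with exponent in `u`. -/
def powerSpan (B : Subalgebra k A) (t : A) (u : Set ℕ) : Submodule B A :=
  Submodule.span B ((fun n => t ^ n) '' u)

theorem mul_pow_mem_powerSpan {B : Subalgebra k A} (t : A) {u : Set ℕ} {b : A} (hb : b ∈ B)
    {n : ℕ} (hn : n ∈ u) : b * t ^ n ∈ powerSpan B t u :=
  Submodule.smul_mem _ (⟨b, hb⟩ : B) (Submodule.subset_span ⟨n, hn, rfl⟩)

theorem powerSpan_induction {B : Subalgebra k A} {t : A} {u : Set ℕ} {p : A → Prop}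
    (h : ∀ b ∈ B, ∀ n ∈ u, p (b * t ^ n)) (h0 : p 0) (hadd : ∀ a b, p a → p b → p (a + b))
    {a : A} (ha : a ∈ powerSpan B t u) : p a := by
  induction ha using Submodule.closure_induction with
  | zero => exact h0
  | add a b _ _ ha hb => exact hadd a b ha hb
  | smul_mem b x hx =>
    obtain ⟨n, hn, rfl⟩ := hx
    exact h b b.2 n hn

theorem mul_mem_powerSpan {B : Subalgebra k A} {t : A}
    (htB : ∀ b ∈ B, t * b - b * t ∈ B) {u v : Set ℕ} (huv : u ⊆ v) (huv' : ∀ n ∈ u, n + 1 ∈ v)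
    {a : A} (ha : a ∈ powerSpan B t u) : t * a ∈ powerSpan B t v := by
  refine powerSpan_induction (p := fun a => t * a ∈ powerSpan B t v) ?_ ?_ ?_ ha
  · intro b hb n hn
    have : t * (b * t ^ n) = b * t ^ (n + 1) + (t * b - b * t) * t ^ n := by
      rw [pow_succ']
      noncomm_ring
    rw [this]
    exact add_mem (mul_pow_mem_powerSpan t hb (huv' n hn))
      (mul_pow_mem_powerSpan t (htB b hb) (huv hn))
  · simp
  · intro a b ha hb
    rw [mul_add]
    exact add_mem ha hb

/-- Since tb = bt + [t,b], the coefficients can always be moved to the left of the powers of t. -/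
theorem adjoin_insert_le_powerSpan {s : Set A} {t : A}
    (h : ∀ b ∈ s, t * b - b * t ∈ Algebra.adjoin k s) {a : A}
    (ha : a ∈ Algebra.adjoin k (insert t s)) :
    a ∈ powerSpan (Algebra.adjoin k s) t Set.univ := by
  -- Stability under left multiplication is the statement that survives induction on `a`; applying
  -- it to 1 gives the claim.
  suffices ∀ v ∈ powerSpan (Algebra.adjoin k s) t Set.univ,
      a * v ∈ powerSpan (Algebra.adjoin k s) t Set.univ by
    have h1 := mul_pow_mem_powerSpan (u := Set.univ) t
      (one_mem (Algebra.adjoin k s)) (Set.mem_univ 0)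
    rw [pow_zero, mul_one] at h1
    simpa using this 1 h1
  induction ha using Algebra.adjoin_induction with
  | mem b hb =>
    intro v hv
    rcases hb with rfl | hb
    · exact mul_mem_powerSpan (commutator_mem_adjoin h) (subset_refl _)
        (fun _ _ => Set.mem_univ _) hv
    · exact Submodule.smul_mem _ (⟨b, Algebra.subset_adjoin hb⟩ : Algebra.adjoin k s) hv
  | algebraMap c =>
    intro v hv
    exact Submodule.smul_mem _ (algebraMap k (Algebra.adjoin k s) c) hv
  | add a b _ _ ha hb =>
    intro v hv
    rw [add_mul]
    exact add_mem (ha v hv) (hb v hv)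
  | mul a b _ _ ha hb =>
    intro v hv
    rw [mul_assoc]
    exact ha _ (hb v hv)

variable {E : Type*} [Ring E] [Algebra k E]

theorem exists_basis_pow_smul {R S M : Type*} [Ring R] [Ring S] [AddCommGroup M] [Module R S]
    [Module S M] [Module R M] [IsScalarTower R S M] (τ : S)
    (hli : LinearIndependent R fun n : ℕ => τ ^ n)
    (hsp : ⊤ ≤ Submodule.span R (Set.range fun n : ℕ => τ ^ n)) {ι : Type*}
    (e : Module.Basis ι S M) :
    ∃ e' : Module.Basis (ℕ × ι) R M, ∀ n i, e' (n, i) = τ ^ n • e i :=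
  ⟨(Module.Basis.mk hli hsp).smulTower e, fun n i => by
    rw [Module.Basis.smulTower_apply, Module.Basis.mk_apply]⟩

/-- The basis of the tower B ⊆ B' ⊆ A consists of the products tⁿeᵢ. Only the recursion in n is
recorded, because that is what the injectivity argument for t' uses. -/
theorem exists_basis_of_le_powerSpan {B B' : Subalgebra k A} (hle : B ≤ B') {t : A} (ht : t ∈ B')
    (hB' : ∀ a ∈ B', a ∈ powerSpan B t Set.univ)
    (hpow : LinearIndependent B (fun n : ℕ => t ^ n)) {ι : Type*} (e : Module.Basis ι B' A) :
    ∃ e' : Module.Basis (ℕ × ι) B A, ∀ n i, e' (n + 1, i) = t * e' (n, i) := by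
  let _ : Module B B' := Module.compHom B' (Subalgebra.inclusion hle).toRingHom
  have : IsScalarTower B B' A := ⟨fun b b' a => mul_assoc (b : A) b' a⟩
  let val : B' →ₗ[B] A :=
    { toFun := Subtype.val
      map_add' := fun _ _ => rfl
      map_smul' := fun _ _ => rfl }
  let τ : B' := ⟨t, ht⟩
  have hval : (val ∘ fun n : ℕ => τ ^ n) = fun n : ℕ => t ^ n :=
    funext fun n => SubmonoidClass.coe_pow τ n
  have hli : LinearIndependent B (fun n : ℕ => τ ^ n) := by
    refine LinearIndependent.of_comp val ?_
    rw [hval]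
    exact hpow
  have hsp : ⊤ ≤ Submodule.span B (Set.range fun n : ℕ => τ ^ n) := by
    rintro a -
    have ha := hB' a.1 a.2
    have hrange : (fun n : ℕ => t ^ n) '' Set.univ = val '' Set.range (fun n : ℕ => τ ^ n) := by
      rw [Set.image_univ, ← Set.range_comp, hval]
    rw [powerSpan, hrange, Submodule.span_image] at ha
    obtain ⟨a', ha', haa'⟩ := ha
    rwa [← Subtype.ext haa']
  obtain ⟨e', he'⟩ := exists_basis_pow_smul τ hli hsp e
  refine ⟨e', fun n i => ?_⟩
  rw [he', he', pow_succ', mul_smul]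
  exact Subalgebra.smul_def _ _

/-- The element `t` normalizes the subalgebra `B`, and in some overring the commutator with an
element `s` kills `B` and maps `t` to an element of `B` which is not a zero divisor there. -/
structure IsOreVariable (j : A →ₐ[k] E) (s : E) (B : Subalgebra k A) (t c : A) : Prop where
  commutator_mem : ∀ b ∈ B, t * b - b * t ∈ B
  commute : ∀ b ∈ B, j b * s = s * j b
  mem : c ∈ B
  commutator_eq : j t * s - s * j t = j c
  eq_zero : ∀ b ∈ B, b * c = 0 → b = 0

namespace IsOreVariable

variable {j : A →ₐ[k] E} {s : E} {B : Subalgebra k A} {t c : A}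

theorem add_right (h : IsOreVariable j s B t c) {b₀ : A} (hb₀ : b₀ ∈ B) :
    IsOreVariable j s B (t + b₀) c where
  commutator_mem b hb := by
    have : (t + b₀) * b - b * (t + b₀) = (t * b - b * t) + (b₀ * b - b * b₀) := by noncomm_ring
    rw [this]
    exact add_mem (h.commutator_mem b hb) (sub_mem (mul_mem hb₀ hb) (mul_mem hb hb₀))
  commute := h.commute
  mem := h.mem
  commutator_eq := by
    rw [map_add, add_mul, mul_add, h.commute b₀ hb₀, add_sub_add_right_eq_sub, h.commutator_eq]
  eq_zero := h.eq_zero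

/-- Commutation with s acts like c·d/dt up to lower powers of t; the lower terms come from moving c
to the left. -/
theorem commutator_pow (h : IsOreVariable j s B t c) (n : ℕ) :
    ∃ v ∈ powerSpan B t (Set.Iio n),
      j (t ^ (n + 1)) * s - s * j (t ^ (n + 1)) = j (((n + 1 : ℕ) : A) * c * t ^ n + v) := by
  induction n with
  | zero => exact ⟨0, zero_mem _, by simpa using h.commutator_eq⟩
  | succ n ih =>
    obtain ⟨v, hv, hvn⟩ := ih
    refine ⟨((n + 1 : ℕ) : A) * (t * c - c * t) * t ^ n + t * v, add_mem ?_ ?_, ?_⟩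
    · exact mul_pow_mem_powerSpan t (mul_mem (natCast_mem B _) (h.commutator_mem c h.mem))
        (Nat.lt_succ_self n)
    · exact mul_mem_powerSpan h.commutator_mem (Set.Iio_subset_Iio (Nat.le_succ n))
        (fun m hm => Nat.succ_lt_succ hm) hv
    · have h1 : j (t ^ (n + 1 + 1)) * s - s * j (t ^ (n + 1 + 1)) =
          j t * (j (t ^ (n + 1)) * s - s * j (t ^ (n + 1))) +
            (j t * s - s * j t) * j (t ^ (n + 1)) := by
        rw [pow_succ' t (n + 1), map_mul]
        noncomm_ring
      rw [h1, hvn, h.commutator_eq, ← map_mul, ← map_mul, ← map_add]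
      congr 1
      have h2 : t * ((n + 1 : ℕ) : A) = ((n + 1 : ℕ) : A) * t := (Nat.cast_commute _ _).symm.eq
      have h3 : t * (((n + 1 : ℕ) : A) * c * t ^ n) =
          ((n + 1 : ℕ) : A) * (t * c - c * t) * t ^ n + ((n + 1 : ℕ) : A) * c * t ^ (n + 1) := by
        rw [← mul_assoc, ← mul_assoc, h2, pow_succ' t n]
        noncomm_ring
      rw [mul_add, h3, Nat.cast_succ (n + 1)]
      noncomm_ring

/-- Commutation with s lowers the degree in t by one and multiplies the leading coefficient b by nc
on the right. Induction gives nbc = 0, hence b = 0 because n is invertible and c can be cancelled.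
-/
theorem eq_zero_of_mul_pow_mem [CharZero k] (hj : Function.Injective j)
    (h : IsOreVariable j s B t c) (n : ℕ) :
    ∀ b ∈ B, b * t ^ n ∈ powerSpan B t (Set.Iio n) → b = 0 := by
  have hcomm : ∀ b ∈ B, ∀ a, j (b * a) * s - s * j (b * a) = j b * (j a * s - s * j a) := by
    intro b hb a
    rw [map_mul, mul_sub, mul_assoc, ← mul_assoc s, ← h.commute b hb, mul_assoc]
  induction n with
  | zero =>
    intro b hb hbt
    simpa [powerSpan] using hbt
  | succ n ih =>
    intro b hb hbt
    have hV : ∀ a ∈ powerSpan B t (Set.Iio (n + 1)),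
        ∃ v ∈ powerSpan B t (Set.Iio n), j a * s - s * j a = j v := by
      intro a ha
      refine powerSpan_induction (p := fun a => ∃ v ∈ powerSpan B t (Set.Iio n),
        j a * s - s * j a = j v) ?_ ⟨0, zero_mem _, by simp⟩ ?_ ha
      · intro b hb m hm
        cases m with
        | zero => exact ⟨0, zero_mem _, by simp [h.commute b hb]⟩
        | succ m =>
          obtain ⟨v, hv, hvm⟩ := h.commutator_pow m
          have hm : m < n := Nat.lt_of_succ_lt_succ hm
          refine ⟨b * (((m + 1 : ℕ) : A) * c * t ^ m + v), ?_, ?_⟩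
          · rw [mul_add, ← mul_assoc]
            exact add_mem (mul_pow_mem_powerSpan t
              (mul_mem hb (mul_mem (natCast_mem B _) h.mem)) hm)
              (Submodule.smul_mem _ (⟨b, hb⟩ : B)
                (Submodule.span_mono (Set.image_mono (Set.Iio_subset_Iio hm.le)) hv))
          · rw [hcomm b hb, hvm, ← map_mul]
      · rintro a b ⟨v, hv, hav⟩ ⟨w, hw, hbw⟩
        refine ⟨v + w, add_mem hv hw, ?_⟩
        rw [map_add, map_add, ← hav, ← hbw]
        noncomm_ring
    obtain ⟨v, hv, hbv⟩ := hV _ hbt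
    obtain ⟨w, hw, hwn⟩ := h.commutator_pow n
    rw [hcomm b hb, hwn, ← map_mul] at hbv
    have hbv := hj hbv
    have hmem : ((n + 1 : ℕ) : A) * (b * c) * t ^ n ∈ powerSpan B t (Set.Iio n) := by
      have : ((n + 1 : ℕ) : A) * (b * c) * t ^ n = v - b * w := by
        rw [← hbv, mul_add, add_sub_cancel_right, ← mul_assoc, ← mul_assoc, ← mul_assoc,
          (Nat.cast_commute (n + 1) b).eq]
      rw [this]
      exact sub_mem hv (Submodule.smul_mem _ (⟨b, hb⟩ : B) hw)
    have h0 := ih _ (mul_mem (natCast_mem B _) (mul_mem hb h.mem)) hmem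
    refine h.eq_zero b hb ?_
    have hk : ((n + 1 : ℕ) : k) ≠ 0 := Nat.cast_ne_zero.2 (Nat.succ_ne_zero n)
    rw [← map_natCast (algebraMap k A), ← Algebra.smul_def] at h0
    exact (smul_eq_zero_iff_right hk).1 h0

theorem linearIndependent_pow [CharZero k] (hj : Function.Injective j)
    (h : IsOreVariable j s B t c) : LinearIndependent B (fun n : ℕ => t ^ n) := by
  rw [linearIndependent_iff]
  intro f hf
  by_contra hne
  have hsupp : f.support.Nonempty := Finsupp.support_nonempty_iff.2 hne
  -- In a nontrivial relation the top term lies in the span of the smaller powers, so its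
  -- coefficient vanishes.
  set n := f.support.max' hsupp with hn
  have hnmem : n ∈ f.support := f.support.max'_mem hsupp
  refine Finsupp.mem_support_iff.1 hnmem (Subtype.ext ?_)
  refine h.eq_zero_of_mul_pow_mem hj n _ (f n).2 ?_
  rw [Finsupp.linearCombination_apply, Finsupp.sum, ← Finset.add_sum_erase _ _ hnmem] at hf
  have : (f n : A) * t ^ n = -∑ i ∈ f.support.erase n, f i • t ^ i := eq_neg_of_add_eq_zero_left hf
  rw [this]
  refine neg_mem (sum_mem fun i hi => mul_pow_mem_powerSpan t (f i).2 ?_)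
  obtain ⟨hin, hi⟩ := Finset.mem_erase.1 hi
  exact lt_of_le_of_ne (f.support.le_max' i hi) hin

/-- The image of ∑ bₙtⁿ is ∑ σ(bₙ)(t + b₀)ⁿ, and t + b₀ is again an Ore variable, so its powers are
independent too. -/
theorem injOn_adjoin_insert [CharZero k] (hj : Function.Injective j) {S : Set A}
    (h : IsOreVariable j s (Algebra.adjoin k S) t c) (σ : A →ₐ[k] A)
    (hσ : ∀ b ∈ Algebra.adjoin k S, σ b ∈ Algebra.adjoin k S)
    (hinj : ∀ b ∈ Algebra.adjoin k S, σ b = 0 → b = 0)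
    {b₀ : A} (hb₀ : b₀ ∈ Algebra.adjoin k S) (ht : σ t = t + b₀) :
    ∀ a ∈ Algebra.adjoin k (insert t S), σ a = 0 → a = 0 := by
  intro a ha ha0
  have ha := adjoin_insert_le_powerSpan
    (fun b hb => h.commutator_mem b (Algebra.subset_adjoin hb)) ha
  rw [powerSpan, Set.image_univ, Finsupp.mem_span_range_iff_exists_finsupp] at ha
  obtain ⟨f, rfl⟩ := ha
  let τ : Algebra.adjoin k S → Algebra.adjoin k S := fun b => ⟨σ b, hσ b b.2⟩
  have hτ : τ 0 = 0 := Subtype.ext (map_zero σ)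
  have hli := (h.add_right hb₀).linearIndependent_pow hj
  rw [linearIndependent_iff] at hli
  have h0 : Finsupp.mapRange τ hτ f = 0 := by
    apply hli
    rw [Finsupp.linearCombination_apply, Finsupp.sum_mapRange_index (by simp), ← ha0,
      Finsupp.sum, Finsupp.sum, map_sum]
    refine Finset.sum_congr rfl fun n _ => ?_
    rw [Subalgebra.smul_def, Subalgebra.smul_def, smul_eq_mul, smul_eq_mul, map_mul, map_pow, ht]
  have : f = 0 := by
    ext n
    have := DFunLike.congr_fun h0 n
    exact hinj _ (f n).2 (congrArg Subtype.val this)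
  rw [this, Finsupp.sum_zero_index]

theorem exists_basis [CharZero k] (hj : Function.Injective j) {S : Set A}
    (h : IsOreVariable j s (Algebra.adjoin k S) t c) {ι : Type*}
    (e : Module.Basis ι (Algebra.adjoin k (insert t S)) A) :
    ∃ e' : Module.Basis (ℕ × ι) (Algebra.adjoin k S) A,
      ∀ n i, e' (n + 1, i) = t * e' (n, i) :=
  exists_basis_of_le_powerSpan (Algebra.adjoin_mono (Set.subset_insert t S))
    (Algebra.subset_adjoin (Set.mem_insert t S))
    (fun _ ha => adjoin_insert_le_powerSpan
      (fun b hb => h.commutator_mem b (Algebra.subset_adjoin hb)) ha)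
    (h.linearIndependent_pow hj) e

end IsOreVariable

end OrePowers
-- Left ideals of the enveloping algebra and the quotients A ⊗_B A.
section EnvelopingIdeals

variable (k : Type v) [Field k] {A : Type u} [Ring A] [Algebra k A]

/-- The element `a ⊗ 1 - 1 ⊗ a` of the enveloping algebra. -/
noncomputable def envDiff (a : A) : EnvAlg k A := a ⊗ₜ[k] 1 - 1 ⊗ₜ[k] op a

/-- The left ideal of the enveloping algebra generated by the elements `b ⊗ 1 - 1 ⊗ b`
with `b ∈ s`. -/
noncomputable def envIdeal (s : Set A) : Submodule (EnvAlg k A) (EnvAlg k A) :=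
  Submodule.span (EnvAlg k A) (envDiff k '' s)

theorem envIdeal_empty : envIdeal k (∅ : Set A) = ⊥ := by
  rw [envIdeal, Set.image_empty, Submodule.span_empty]

theorem envIdeal_insert (t : A) (s : Set A) :
    envIdeal k (insert t s) = envIdeal k s ⊔ Submodule.span (EnvAlg k A) {envDiff k t} := by
  rw [envIdeal, Set.image_insert_eq, Submodule.span_insert, sup_comm]
  rfl

theorem envDiff_add (a b : A) : envDiff k (a + b) = envDiff k a + envDiff k b := by
  simp only [envDiff, MulOpposite.op_add, TensorProduct.add_tmul, TensorProduct.tmul_add]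
  abel

theorem envDiff_sub (a b : A) : envDiff k (a - b) = envDiff k a - envDiff k b := by
  simp only [envDiff, MulOpposite.op_sub, TensorProduct.sub_tmul, TensorProduct.tmul_sub]
  abel

theorem envDiff_mul (a b : A) :
    envDiff k (a * b) = (a ⊗ₜ[k] 1) * envDiff k b + (1 ⊗ₜ[k] op b) * envDiff k a := by
  simp only [envDiff, mul_sub, Algebra.TensorProduct.tmul_mul_tmul, one_mul, mul_one, MulOpposite.op_mul]
  abel

theorem envDiff_algebraMap (c : k) : envDiff k (algebraMap k A c) = 0 := by
  rw [envDiff, Algebra.algebraMap_eq_smul_one, MulOpposite.op_smul, TensorProduct.smul_tmul,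
    op_one, sub_self]

/-- The assignment a ↦ a' respects commutators, so the Ore relations of A carry over to the
enveloping algebra. -/
theorem envDiff_mul_envDiff (t b : A) :
    envDiff k b * envDiff k t = envDiff k t * envDiff k b - envDiff k (t * b - b * t) := by
  simp only [envDiff, mul_sub, sub_mul, Algebra.TensorProduct.tmul_mul_tmul, one_mul, mul_one,
    MulOpposite.op_mul, MulOpposite.op_sub, TensorProduct.sub_tmul, TensorProduct.tmul_sub]
  abel

theorem tmul_mul_envDiff (a d b : A) :
    (a ⊗ₜ[k] op d : EnvAlg k A) * envDiff k b =
      (a * b) ⊗ₜ[k] op d - a ⊗ₜ[k] op (b * d) := by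
  simp only [envDiff, mul_sub, Algebra.TensorProduct.tmul_mul_tmul, mul_one, MulOpposite.op_mul]

variable {k}

theorem envDiff_mem_of_mem_adjoin {s : Set A} {I : Submodule (EnvAlg k A) (EnvAlg k A)}
    (h : ∀ b ∈ s, envDiff k b ∈ I) : ∀ b ∈ Algebra.adjoin k s, envDiff k b ∈ I := by
  intro b hb
  induction hb using Algebra.adjoin_induction with
  | mem b hb => exact h b hb
  | algebraMap c =>
    rw [envDiff_algebraMap]
    exact zero_mem _
  | add a b _ _ ha hb =>
    rw [envDiff_add]
    exact add_mem ha hb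
  | mul a b _ _ ha hb =>
    rw [envDiff_mul]
    exact add_mem (I.smul_mem _ hb) (I.smul_mem _ ha)

theorem envDiff_mem_envIdeal {s : Set A} {b : A} (hb : b ∈ Algebra.adjoin k s) :
    envDiff k b ∈ envIdeal k s :=
  envDiff_mem_of_mem_adjoin (fun _ hb => Submodule.subset_span (Set.mem_image_of_mem _ hb)) b hb

theorem envIdeal_induction {s : Set A} {p : EnvAlg k A → Prop}
    (h : ∀ a d, ∀ b ∈ s, p ((a ⊗ₜ[k] op d : EnvAlg k A) * envDiff k b)) (h0 : p 0)
    (hadd : ∀ a b, p a → p b → p (a + b)) {z : EnvAlg k A} (hz : z ∈ envIdeal k s) : p z := by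
  induction hz using Submodule.closure_induction with
  | zero => exact h0
  | add a b _ _ ha hb => exact hadd a b ha hb
  | smul_mem w x hx =>
    obtain ⟨b, hb, rfl⟩ := hx
    induction w using TensorProduct.induction_on with
    | zero =>
      rw [smul_eq_mul, zero_mul]
      exact h0
    | tmul a d => exact h a d.unop b hb
    | add v w hv hw =>
      rw [smul_eq_mul, add_mul]
      exact hadd _ _ hv hw

theorem mul_mem_envIdeal {s : Set A} {w : EnvAlg k A}
    (h : ∀ b ∈ s, envDiff k b * w ∈ envIdeal k s) : ∀ z ∈ envIdeal k s, z * w ∈ envIdeal k s := by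
  intro z hz
  refine envIdeal_induction (p := fun z => z * w ∈ envIdeal k s) ?_ ?_ ?_ hz
  · intro a d b hb
    rw [mul_assoc]
    exact Submodule.smul_mem _ _ (h b hb)
  · simp
  · intro a b ha hb
    rw [add_mul]
    exact add_mem ha hb

theorem mul_envDiff_mem_envIdeal {s : Set A} {t : A}
    (h : ∀ b ∈ s, t * b - b * t ∈ Algebra.adjoin k s) :
    ∀ z ∈ envIdeal k s, z * envDiff k t ∈ envIdeal k s := by
  refine mul_mem_envIdeal fun b hb => ?_
  rw [envDiff_mul_envDiff]
  exact sub_mem (Submodule.smul_mem _ _ (envDiff_mem_envIdeal (Algebra.subset_adjoin hb)))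
    (envDiff_mem_envIdeal (h b hb))

section Coordinates

variable {B : Subalgebra k A} {ι : Type*} (e : Module.Basis ι B A)

/-- The coordinates of an element of `A ⊗ A` modulo the relations `a b ⊗ d = a ⊗ b d` with
`b ∈ B`, in terms of a basis of `A` as a left `B`-module. -/
noncomputable def envCoord : EnvAlg k A →ₗ[k] (ι →₀ A) :=
  TensorProduct.lift (LinearMap.mk₂ k
    (fun (a : A) (d : Aᵐᵒᵖ) => (e.repr d.unop).mapRange (fun b : B => a * (b : A)) (mul_zero a))
    (fun a a' d => by ext i; simp [add_mul])
    (fun c a d => by ext i; simp)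
    (fun a d d' => by ext i; simp [mul_add])
    (fun c a d => by
      ext i
      have : e.repr (c • d.unop) = (algebraMap k B c) • e.repr d.unop := by
        rw [← map_smul, algebraMap_smul]
      rw [unop_smul, this, Finsupp.mapRange_apply, Finsupp.smul_apply, Finsupp.smul_apply,
        Finsupp.mapRange_apply, smul_eq_mul, MulMemClass.coe_mul, Algebra.smul_def c, ← mul_assoc,
        ← mul_assoc]
      exact congrArg (· * _) (Algebra.commutes c a).symm))

theorem envCoord_tmul (a d : A) (i : ι) :
    envCoord e (a ⊗ₜ[k] op d) i = a * (e.repr d i : A) := rfl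

theorem envCoord_tmul_basis (a : A) (i : ι) :
    envCoord e (a ⊗ₜ[k] op (e i)) = Finsupp.single i a := by
  classical
  ext j
  rw [envCoord_tmul, e.repr_self, Finsupp.single_apply, Finsupp.single_apply]
  split_ifs <;> simp

/-- The element of `A ⊗ A` with given coordinates. -/
noncomputable def envOfCoord : (ι →₀ A) →+ EnvAlg k A :=
  Finsupp.liftAddHom fun i =>
    AddMonoidHom.mk' (fun a => (a ⊗ₜ[k] op (e i) : EnvAlg k A)) fun a b =>
      TensorProduct.add_tmul a b _

theorem envOfCoord_single (i : ι) (a : A) :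
    envOfCoord e (Finsupp.single i a) = (a ⊗ₜ[k] op (e i) : EnvAlg k A) :=
  Finsupp.liftAddHom_apply_single _ _ _

theorem envCoord_eq_zero {s : Set A} (hs : s ⊆ B) {z : EnvAlg k A} (hz : z ∈ envIdeal k s) :
    envCoord e z = 0 := by
  refine envIdeal_induction (p := fun z => envCoord e z = 0) ?_ (map_zero _) ?_ hz
  · intro a d b hb
    have : e.repr (b * d) = (⟨b, hs hb⟩ : B) • e.repr d := by
      rw [← map_smul]
      rfl
    ext i
    rw [tmul_mul_envDiff, map_sub, Finsupp.sub_apply, envCoord_tmul, envCoord_tmul, this]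
    simp [mul_assoc]
  · intro a b ha hb
    rw [map_add, ha, hb, add_zero]

/-- Scalars from B cross the tensor sign modulo the ideal, so every tensor reduces to one whose
right factors are basis elements. This makes the coordinates an isomorphism from A ⊗_B A to a direct
sum of copies of A. -/
theorem sub_envOfCoord_mem (s : Set A) (e : Module.Basis ι (Algebra.adjoin k s) A)
    (z : EnvAlg k A) : z - envOfCoord e (envCoord e z) ∈ envIdeal k s := by
  induction z using TensorProduct.induction_on with
  | zero => simp
  | add v w hv hw =>
    rw [map_add, map_add, add_sub_add_comm]
    exact add_mem hv hw
  | tmul a d =>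
    obtain ⟨d, rfl⟩ := op_surjective d
    obtain ⟨f, rfl⟩ := e.repr.symm.surjective d
    induction f using Finsupp.induction_linear with
    | zero => simp
    | add f g hf hg =>
      rw [map_add, MulOpposite.op_add, TensorProduct.tmul_add, map_add, map_add,
        add_sub_add_comm]
      exact add_mem hf hg
    | single i r =>
      have hc : envCoord e (a ⊗ₜ[k] op (e.repr.symm (Finsupp.single i r))) =
          Finsupp.single i (a * (r : A)) := by
        classical
        ext j
        rw [envCoord_tmul, LinearEquiv.apply_symm_apply, Finsupp.single_apply,
          Finsupp.single_apply]
        split_ifs <;> simp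
      rw [hc, envOfCoord_single, e.repr_symm_single, Subalgebra.smul_def, smul_eq_mul,
        ← neg_sub, ← tmul_mul_envDiff]
      exact neg_mem (Submodule.smul_mem _ _ (envDiff_mem_envIdeal r.2))

theorem mem_envIdeal_iff {s : Set A} (e : Module.Basis ι (Algebra.adjoin k s) A)
    {z : EnvAlg k A} : z ∈ envIdeal k s ↔ envCoord e z = 0 := by
  refine ⟨envCoord_eq_zero e Algebra.subset_adjoin, fun h => ?_⟩
  have := sub_envOfCoord_mem s e z
  rwa [h, map_zero, sub_zero] at this

/-- Multiplication by t' sends a ⊗ e(n,i) to at ⊗ e(n,i) - a ⊗ e(n+1,i): it multiplies coordinates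
by t and subtracts a shift. -/
theorem envCoord_envOfCoord_mul_envDiff {t : A} (e : Module.Basis (ℕ × ι) B A)
    (he : ∀ n i, e (n + 1, i) = t * e (n, i)) (f : ℕ × ι →₀ A) (n : ℕ) (i : ι) :
    envCoord e (envOfCoord e f * envDiff k t) (n + 1, i) = f (n + 1, i) * t - f (n, i) := by
  classical
  induction f using Finsupp.induction_linear with
  | zero => simp
  | add f g hf hg =>
    rw [map_add, add_mul, map_add, Finsupp.add_apply, hf, hg, Finsupp.add_apply,
      Finsupp.add_apply, add_mul]
    abel
  | single p a =>
    obtain ⟨m, j⟩ := p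
    rw [envOfCoord_single, tmul_mul_envDiff, ← he, map_sub, envCoord_tmul_basis,
      envCoord_tmul_basis, Finsupp.sub_apply]
    simp only [Finsupp.single_apply, Prod.mk.injEq, Nat.add_right_cancel_iff, ite_mul, zero_mul]

/-- Right multiplication by `t ⊗ 1 - 1 ⊗ t` on `A ⊗_B A` is injective if `A` has a basis as
a left `B`-module which is built from powers of `t`. -/
theorem mem_envIdeal_of_mul_envDiff_mem {s : Set A} {t : A}
    (e : Module.Basis (ℕ × ι) (Algebra.adjoin k s) A)
    (he : ∀ n i, e (n + 1, i) = t * e (n, i))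
    (ht : ∀ b ∈ s, t * b - b * t ∈ Algebra.adjoin k s) (z : EnvAlg k A)
    (hz : z * envDiff k t ∈ envIdeal k s) : z ∈ envIdeal k s := by
  rw [mem_envIdeal_iff e]
  set f := envCoord e z with hf
  have hfz : envOfCoord e f * envDiff k t ∈ envIdeal k s := by
    have h := mul_envDiff_mem_envIdeal ht _ (sub_envOfCoord_mem s e z)
    rw [sub_mul] at h
    have := sub_mem hz h
    rwa [sub_sub_cancel] at this
  -- In the kernel each coordinate is the next one times t. Finite support then forces all of them
  -- to vanish, with no cancellation property of t.
  have hstep : ∀ n i, f (n, i) = f (n + 1, i) * t := by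
    intro n i
    have := envCoord_envOfCoord_mul_envDiff e he f n i
    rw [(mem_envIdeal_iff e).1 hfz, Finsupp.zero_apply] at this
    exact (sub_eq_zero.1 this.symm).symm
  have hiter : ∀ m n i, f (n, i) = f (n + m, i) * t ^ m := by
    intro m
    induction m with
    | zero => intro n i; simp
    | succ m ih =>
      intro n i
      rw [ih n i, hstep, pow_succ', mul_assoc, add_assoc]
  ext ⟨n, i⟩
  -- The added 1 puts the index strictly beyond the support.
  have hlarge : f (n + (f.support.sup Prod.fst + 1), i) = 0 := by
    by_contra h
    have := Finset.le_sup (f := Prod.fst) (Finsupp.mem_support_iff.2 h)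
    dsimp only at this
    omega
  rw [hiter (f.support.sup Prod.fst + 1) n i, hlarge, zero_mul, Finsupp.zero_apply]

end Coordinates

/-- The multiplication map of `A`, as a map of bimodules. -/
noncomputable def envMul (k : Type v) [Field k] (A : Type u) [Ring A] [Algebra k A] :
    EnvAlg k A →ₗ[EnvAlg k A] regularBimodule k A :=
  letI : Module (EnvAlg k A) A := instModuleTensorProductMop k A
  LinearMap.toSpanSingleton (EnvAlg k A) A 1

theorem envMul_tmul (a d : A) : envMul k A (a ⊗ₜ[k] op d) = (a * d : A) := by
  have h := AlgHom.mulLeftRight_apply k A a (op d) 1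
  rw [mul_one] at h
  exact h

theorem envMul_surjective : Function.Surjective (envMul k A) := fun a =>
  ⟨(show A from a) ⊗ₜ[k] op 1,
    (envMul_tmul (k := k) (A := A) a 1).trans (mul_one (show A from a))⟩

theorem ker_envMul {s : Set A} (hs : Algebra.adjoin k s = ⊤) :
    LinearMap.ker (envMul k A) = envIdeal k s := by
  have hmem : ∀ a, envDiff k a ∈ envIdeal k s := fun a =>
    envDiff_mem_envIdeal (by rw [hs]; exact Algebra.mem_top)
  apply le_antisymm
  · have key : ∀ z : EnvAlg k A, z - (show A from envMul k A z) ⊗ₜ[k] 1 ∈ envIdeal k s := by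
      intro z
      induction z using TensorProduct.induction_on with
      | zero =>
        rw [map_zero]
        change (0 : EnvAlg k A) - (0 : A) ⊗ₜ[k] 1 ∈ _
        rw [TensorProduct.zero_tmul, sub_zero]
        exact zero_mem _
      | add v w hv hw =>
        rw [map_add]
        change v + w - ((show A from envMul k A v) + (show A from envMul k A w)) ⊗ₜ[k] 1 ∈ _
        rw [TensorProduct.add_tmul, add_sub_add_comm]
        exact add_mem hv hw
      | tmul a d =>
        obtain ⟨d, rfl⟩ := op_surjective d
        rw [envMul_tmul]
        have : (a ⊗ₜ[k] op d : EnvAlg k A) - (a * d) ⊗ₜ[k] 1 =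
            -((a ⊗ₜ[k] op 1 : EnvAlg k A) * envDiff k d) := by
          rw [tmul_mul_envDiff, mul_one, neg_sub, MulOpposite.op_one]
        exact this ▸ neg_mem (Submodule.smul_mem _ _ (hmem d))
    intro z hz
    have h := key z
    rw [LinearMap.mem_ker.1 hz] at h
    change z - (0 : A) ⊗ₜ[k] 1 ∈ _ at h
    rwa [TensorProduct.zero_tmul, sub_zero] at h
  · refine Submodule.span_le.2 ?_
    rintro _ ⟨b, -, rfl⟩
    change envMul k A (envDiff k b) = 0
    rw [envDiff, map_sub, ← MulOpposite.op_one, envMul_tmul, envMul_tmul, mul_one, one_mul]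
    exact sub_self (b : A)

/-- If `s` generates `A`, the regular bimodule is the quotient of `Aᵉ` by `envIdeal k s`. -/
noncomputable def quotientEnvIdealEquiv {s : Set A} (hs : Algebra.adjoin k s = ⊤) :
    (EnvAlg k A ⧸ envIdeal k s) ≃ₗ[EnvAlg k A] regularBimodule k A :=
  (Submodule.quotEquivOfEq _ _ (ker_envMul hs).symm).trans
    ((envMul k A).quotKerEquivOfSurjective envMul_surjective)

end EnvelopingIdeals
-- The twisted anti-automorphism and the bimodule A_σ.
section TwistedFlip

variable {k : Type v} [Field k] {A : Type u} [Ring A] [Algebra k A]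

theorem envFlip_envFlip (z : EnvAlg k A) : (envFlip k A (envFlip k A z).unop).unop = z := by
  induction z using TensorProduct.induction_on with
  | zero => simp
  | add v w hv hw => rw [map_add, MulOpposite.unop_add, map_add, MulOpposite.unop_add, hv, hw]
  | tmul a d =>
    obtain ⟨d, rfl⟩ := op_surjective d
    rw [envFlip_tmul, unop_op, envFlip_tmul, unop_op]

/-- The anti-automorphism `a ⊗ b ↦ σ⁻¹(b) ⊗ a` of the enveloping algebra. -/
noncomputable def twistedFlip (σ : A ≃ₐ[k] A) : EnvAlg k A ≃+* (EnvAlg k A)ᵐᵒᵖ :=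
  (RingEquiv.ofBijective (envFlip k A).toRingHom
    ⟨fun z w h => by
        rw [← envFlip_envFlip z, ← envFlip_envFlip w]
        exact congrArg (fun v => (envFlip k A (unop v)).unop) h,
      fun z => ⟨(envFlip k A z.unop).unop, unop_injective (envFlip_envFlip z.unop)⟩⟩).trans
    (RingEquiv.op (Algebra.TensorProduct.congr σ.symm
      (AlgEquiv.refl : Aᵐᵒᵖ ≃ₐ[k] Aᵐᵒᵖ)).toRingEquiv)

theorem twistedFlip_tmul (σ : A ≃ₐ[k] A) (a d : A) :
    (twistedFlip σ (a ⊗ₜ[k] op d)).unop = σ.symm d ⊗ₜ[k] op a := by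
  change Algebra.TensorProduct.congr σ.symm (AlgEquiv.refl : Aᵐᵒᵖ ≃ₐ[k] Aᵐᵒᵖ)
    (envFlip k A (a ⊗ₜ[k] op d)).unop = _
  rw [envFlip_tmul, unop_op, Algebra.TensorProduct.congr_apply, Algebra.TensorProduct.map_tmul]
  rfl

/-- This identity is where σ enters: it decides which transposes satisfy the sign condition θ(t*) ≡
-t'. -/
theorem twistedFlip_twistedDiff (σ : A ≃ₐ[k] A) (a : A) :
    (twistedFlip σ (a ⊗ₜ[k] 1 - 1 ⊗ₜ[k] op (σ a))).unop = -envDiff k a := by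
  rw [map_sub, MulOpposite.unop_sub, ← MulOpposite.op_one, twistedFlip_tmul, twistedFlip_tmul, map_one,
    AlgEquiv.symm_apply_apply, MulOpposite.op_one, envDiff, neg_sub]

/-- The map `a ⊗ b ↦ b σ(a)` from the enveloping algebra to the twisted bimodule. -/
noncomputable def twistedMul (σ : A ≃ₐ[k] A) : EnvAlg k A →+ TwistedBimodule σ :=
  AddMonoidHom.mk' (fun z => σ (show A from envMul k A (twistedFlip σ z).unop)) fun z w => by
    have : envMul k A (twistedFlip σ (z + w)).unop =
        envMul k A (twistedFlip σ z).unop + envMul k A (twistedFlip σ w).unop := by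
      rw [map_add, MulOpposite.unop_add, map_add]
    exact (congrArg (fun a : A => σ a) this).trans (map_add σ _ _)

theorem twistedMul_tmul (σ : A ≃ₐ[k] A) (a d : A) :
    twistedMul σ (a ⊗ₜ[k] op d) = (d * σ a : A) := by
  change σ (show A from envMul k A (twistedFlip σ (a ⊗ₜ[k] op d)).unop) = _
  rw [twistedFlip_tmul, envMul_tmul, map_mul, AlgEquiv.apply_symm_apply]

theorem twistedMul_surjective (σ : A ≃ₐ[k] A) : Function.Surjective (twistedMul σ) := by
  intro a
  refine ⟨1 ⊗ₜ[k] op (show A from a), ?_⟩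
  rw [twistedMul_tmul, map_one, mul_one]

theorem twistedMul_eq_zero_iff (σ : A ≃ₐ[k] A) {s : Set A} (hs : Algebra.adjoin k s = ⊤)
    (z : EnvAlg k A) : twistedMul σ z = 0 ↔ (twistedFlip σ z).unop ∈ envIdeal k s := by
  rw [← ker_envMul hs]
  exact map_eq_zero_iff σ σ.injective

/-- The inner bimodule structure on the enveloping algebra becomes the twisted structure: c ⊗ d
times b ⊗ a is cb ⊗ ad, which maps to a(dσ(c))σ(b). -/
theorem twistedMul_mul_envFlip (σ : A ≃ₐ[k] A) (w z : EnvAlg k A) :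
    twistedMul σ (z * (envFlip k A w).unop) = w • twistedMul σ z := by
  induction w using TensorProduct.induction_on with
  | zero =>
    rw [map_zero, MulOpposite.unop_zero, mul_zero, map_zero]
    exact (zero_smul (EnvAlg k A) (twistedMul σ z)).symm
  | add v w hv hw => rw [map_add, MulOpposite.unop_add, mul_add, map_add, hv, hw, add_smul]
  | tmul a b =>
    obtain ⟨b, rfl⟩ := op_surjective b
    induction z using TensorProduct.induction_on with
    | zero => rw [zero_mul, map_zero, smul_zero]
    | add v w hv hw => rw [add_mul, map_add, hv, hw, map_add, smul_add]
    | tmul c d =>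
      obtain ⟨d, rfl⟩ := op_surjective d
      rw [envFlip_tmul, unop_op, Algebra.TensorProduct.tmul_mul_tmul, ← MulOpposite.op_mul,
        twistedMul_tmul, twistedMul_tmul, map_mul]
      refine Eq.trans ?_ (twistedBimodule_smul σ a b (d * σ c)).symm
      change a * d * (σ c * σ b) = a * (d * σ c) * σ b
      noncomm_ring

theorem nonempty_linearEquiv_of_ker_eq {R M N : Type*} [Ring R] [AddCommGroup M] [Module R M]
    [AddCommGroup N] [Module R N] (f : R →+ M) (g : R →+ N) (hf : Function.Surjective f)
    (hg : Function.Surjective g) (hfg : ∀ z, f z = 0 ↔ g z = 0) (φ : R → R)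
    (hfφ : ∀ w z, f (z * φ w) = w • f z) (hgφ : ∀ w z, g (z * φ w) = w • g z) :
    Nonempty (M ≃ₗ[R] N) := by
  have hker : f.ker = g.ker := AddSubgroup.ext hfg
  let e : M ≃+ N := (QuotientAddGroup.quotientKerEquivOfSurjective f hf).symm.trans
    ((QuotientAddGroup.quotientAddEquivOfEq hker).trans
      (QuotientAddGroup.quotientKerEquivOfSurjective g hg))
  have he : ∀ z, e (f z) = g z := by
    intro z
    have : (QuotientAddGroup.quotientKerEquivOfSurjective f hf).symm (f z) =
        QuotientAddGroup.mk z := by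
      rw [AddEquiv.symm_apply_eq]
      rfl
    change QuotientAddGroup.quotientKerEquivOfSurjective g hg
      (QuotientAddGroup.quotientAddEquivOfEq hker
        ((QuotientAddGroup.quotientKerEquivOfSurjective f hf).symm (f z))) = _
    rw [this]
    rfl
  refine ⟨e.toLinearEquiv fun w x => ?_⟩
  obtain ⟨z, rfl⟩ := hf x
  rw [← hfφ, he, he, hgφ]

/-- The presentation of Ext^d and the map a ⊗ b ↦ bσ(a) onto A_σ are surjections from the enveloping
algebra with the same kernel and the same compatibility with the action, so their targets are
isomorphic. -/
theorem IsDualPresentation.isTwistedCalabiYau {σ : A ≃ₐ[k] A} {s : Set A}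
    (hs : Algebra.adjoin k s = ⊤) {n d : ℕ}
    (hres : HasFiniteProjectiveResolution (EnvAlg k A) n
      (ModuleCat.of (EnvAlg k A) (EnvAlg k A ⧸ envIdeal k s)))
    {ρ : EnvAlg k A →+ CyclicExt (envIdeal k s) d}
    (hρ : IsDualPresentation (twistedFlip σ) (envIdeal k s) d ρ) :
    IsTwistedCalabiYau k A d σ := by
  let e : ModuleCat.of (EnvAlg k A) (EnvAlg k A ⧸ envIdeal k s) ≅ regularBimodule k A :=
    LinearEquiv.toModuleIso (quotientEnvIdealEquiv hs)
  have hinv : ∀ (i : ℕ) (x : Abelian.Ext.{u} (regularBimodule k A) (envBimodule k A) i),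
      (Abelian.Ext.mk₀ e.inv).comp ((Abelian.Ext.mk₀ e.hom).comp x (zero_add i)) (zero_add i) =
        x := by
    intro i x
    rw [Abelian.Ext.mk₀_comp_mk₀_assoc, Iso.inv_hom_id, Abelian.Ext.mk₀_id_comp]
  have hhom : ∀ (i : ℕ) (x : CyclicExt (envIdeal k s) i),
      (Abelian.Ext.mk₀ e.hom).comp ((Abelian.Ext.mk₀ e.inv).comp x (zero_add i)) (zero_add i) =
        x := by
    intro i x
    rw [Abelian.Ext.mk₀_comp_mk₀_assoc, Iso.hom_inv_id, Abelian.Ext.mk₀_id_comp]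
  refine ⟨?_, ?_, ?_⟩
  · exact (hres.of_linearEquiv (quotientEnvIdealEquiv hs)).exists_projectiveResolution
  · intro i hi
    have := hρ.subsingleton i hi
    refine ⟨fun x y => ?_⟩
    have h : (Abelian.Ext.mk₀ e.hom).comp x (zero_add i) =
        (Abelian.Ext.mk₀ e.hom).comp y (zero_add i) :=
      Subsingleton.elim (α := CyclicExt (envIdeal k s) i) _ _
    have hx := hinv i x
    rw [h, hinv i y] at hx
    exact hx.symm
  · let f : EnvAlg k A →+ ExtEnv k A d :=
      AddMonoidHom.comp ((Abelian.Ext.mk₀ e.inv).precomp (envBimodule k A) (zero_add d)) ρ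
    have hf : ∀ z, f z = (Abelian.Ext.mk₀ e.inv).comp (ρ z) (zero_add d) := fun z => rfl
    refine nonempty_linearEquiv_of_ker_eq f (twistedMul σ) ?_ (twistedMul_surjective σ) ?_
      (fun w => (envFlip k A w).unop) ?_ (twistedMul_mul_envFlip σ)
    · intro x
      obtain ⟨z, hz⟩ := hρ.surjective ((Abelian.Ext.mk₀ e.hom).comp x (zero_add d))
      refine ⟨z, ?_⟩
      rw [hf, hz]
      exact hinv d x
    · intro z
      rw [twistedMul_eq_zero_iff σ hs, ← hρ.eq_zero_iff]
      constructor
      · intro h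
        have h' : (Abelian.Ext.mk₀ e.inv).comp (ρ z) (zero_add d) = 0 := h
        have hz := hhom d (ρ z)
        rw [h', Abelian.Ext.comp_zero] at hz
        exact hz.symm
      · intro h
        rw [hf, h]
        exact Abelian.Ext.comp_zero _ _ _ _ _
    · intro w z
      rw [hf, hρ.apply_mul]
      exact (Abelian.Ext.comp_assoc_of_third_deg_zero _ _ _ _).symm

end TwistedFlip
-- The four-step induction along x, y, D, E.
section FourGenerators

variable {k : Type v} [Field k] {A : Type u} [Ring A] [Algebra k A]

theorem IsDualPresentation.exists_envIdeal_insert {θ : EnvAlg k A ≃+* (EnvAlg k A)ᵐᵒᵖ}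
    {s : Set A} {i : ℕ} {ρ : EnvAlg k A →+ CyclicExt (envIdeal k s) i}
    (hρ : IsDualPresentation θ (envIdeal k s) i ρ) {t : A} {t' : EnvAlg k A}
    (ht : ∀ z ∈ envIdeal k s, z * envDiff k t ∈ envIdeal k s)
    (hinj : ∀ z, z * envDiff k t ∈ envIdeal k s → z ∈ envIdeal k s)
    (htt' : IsTranspose ρ (envDiff k t) ht t')
    (hθ : (θ t').unop + envDiff k t ∈ envIdeal k s) :
    ∃ ρ' : EnvAlg k A →+ CyclicExt (envIdeal k (insert t s)) (i + 1),
      IsDualPresentation θ (envIdeal k (insert t s)) (i + 1) ρ' ∧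
      ∀ (w w₀ w' : EnvAlg k A) (_ : ∀ z ∈ envIdeal k s, z * w ∈ envIdeal k s)
        (hw₀ : ∀ z ∈ envIdeal k s, z * w₀ ∈ envIdeal k s)
        (hw : ∀ z ∈ envIdeal k (insert t s), z * w ∈ envIdeal k (insert t s)),
        envDiff k t * w - w₀ * envDiff k t ∈ envIdeal k s →
        IsTranspose ρ w₀ hw₀ w' → IsTranspose ρ' w hw w' := by
  rw [envIdeal_insert]
  obtain ⟨ρ', hρ', h⟩ := hρ.exists_sup_span ht hinj htt' hθ
  exact ⟨ρ', hρ', fun w w₀ w' hws hw₀ _ hc hww' => h w w₀ w' hws hw₀ hc hww'⟩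

theorem HasFiniteProjectiveResolution.envIdeal_insert {n : ℕ} {s : Set A} {t : A}
    (h : HasFiniteProjectiveResolution (EnvAlg k A) n
      (ModuleCat.of (EnvAlg k A) (EnvAlg k A ⧸ envIdeal k s)))
    (ht : ∀ z ∈ envIdeal k s, z * envDiff k t ∈ envIdeal k s)
    (hinj : ∀ z, z * envDiff k t ∈ envIdeal k s → z ∈ envIdeal k s) :
    HasFiniteProjectiveResolution (EnvAlg k A) (n + 1)
      (ModuleCat.of (EnvAlg k A) (EnvAlg k A ⧸ envIdeal k (insert t s))) := by
  rw [_root_.envIdeal_insert]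
  exact h.sup_span ht hinj

theorem mul_sub_intCast_mem {R : Type*} [Ring R] {I : Submodule R R} {w : R}
    (hw : ∀ z ∈ I, z * w ∈ I) (n : ℤ) : ∀ z ∈ I, z * (w - n) ∈ I := by
  intro z hz
  rw [mul_sub]
  refine sub_mem (hw z hz) ?_
  rw [← (Int.cast_commute n z).eq, ← smul_eq_mul]
  exact I.smul_mem _ hz

/-- An iterated Ore extension `k[x][y][D][E]` with the commutation relations of the operators
tangent to a line arrangement is twisted Calabi-Yau of dimension four. The elements `G` and `H`
are divided differences of `f = [D, y]`. -/
theorem isTwistedCalabiYau_of_generators (σ : A ≃ₐ[k] A) {x y D E f g : A} {r : ℤ}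
    (hgen : Algebra.adjoin k ({E, D, y, x} : Set A) = ⊤)
    (hyx : y * x - x * y = 0) (hDx : D * x - x * D = 0) (hDy : D * y - y * D = f)
    (hEx : E * x - x * E = x) (hEy : E * y - y * E = y) (hED : E * D - D * E = (r : A) * D)
    (hσx : σ x = x) (hσy : σ y = y) (hσD : σ D = D + g) (hσE : σ E = E + ((r + 2 : ℤ) : A))
    (hf : f ∈ Algebra.adjoin k ({y, x} : Set A)) {G H : EnvAlg k A}
    (hGH : envDiff k f = G * envDiff k y + H * envDiff k x)
    (hGx : G * envDiff k x = envDiff k x * G)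
    (hG : (twistedFlip σ (1 ⊗ₜ[k] op g - G)).unop ∈ envIdeal k ({y, x} : Set A))
    (hx : ∀ z, z * envDiff k x ∈ envIdeal k (∅ : Set A) → z ∈ envIdeal k (∅ : Set A))
    (hy : ∀ z, z * envDiff k y ∈ envIdeal k ({x} : Set A) → z ∈ envIdeal k ({x} : Set A))
    (hD : ∀ z, z * envDiff k D ∈ envIdeal k ({y, x} : Set A) → z ∈ envIdeal k ({y, x} : Set A))
    (hE : ∀ z, z * envDiff k E ∈ envIdeal k ({D, y, x} : Set A) →
      z ∈ envIdeal k ({D, y, x} : Set A)) :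
    IsTwistedCalabiYau k A 4 σ := by
  rw [← insert_empty_eq x] at *
  set x' := envDiff k x
  set y' := envDiff k y
  set D' := envDiff k D
  set E' := envDiff k E
  have hcomm : ∀ a b : A, envDiff k a * envDiff k b - envDiff k b * envDiff k a =
      envDiff k (a * b - b * a) := by
    intro a b
    rw [envDiff_mul_envDiff k a b, sub_sub_cancel]
  have hyx' : y' * x' - x' * y' = 0 := by rw [hcomm, hyx, ← sub_self (0 : A), envDiff_sub, sub_self]
  have hDx' : D' * x' - x' * D' = 0 := by rw [hcomm, hDx, ← sub_self (0 : A), envDiff_sub, sub_self]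
  have hDy' : D' * y' - y' * D' = G * y' + H * x' := by rw [hcomm, hDy, hGH]
  have hEx' : E' * x' - x' * E' = x' := by rw [hcomm, hEx]
  have hEy' : E' * y' - y' * E' = y' := by rw [hcomm, hEy]
  have hr : ∀ a : A, envDiff k ((r : A) * a) = (r : EnvAlg k A) * envDiff k a := by
    intro a
    have h0 : envDiff k (r : A) = 0 := by
      rw [← map_intCast (algebraMap k A), envDiff_algebraMap]
    rw [envDiff_mul, h0, mul_zero, add_zero]
    congr 1
  have hED' : E' * D' - D' * E' = (r : EnvAlg k A) * D' := by rw [hcomm, hED, hr]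
  have hdiff : ∀ {s : Set A} {b : A}, b ∈ s → envDiff k b ∈ envIdeal k s :=
    fun hb => envDiff_mem_envIdeal (Algebra.subset_adjoin hb)
  -- the idealizers
  have nempty : ∀ w, ∀ z ∈ envIdeal k (∅ : Set A), z * w ∈ envIdeal k (∅ : Set A) :=
    fun w => mul_mem_envIdeal fun b hb => absurd hb (Set.notMem_empty b)
  have ny1 : ∀ z ∈ envIdeal k (insert x ∅), z * y' ∈ envIdeal k (insert x ∅) := by
    refine mul_envDiff_mem_envIdeal ?_
    rintro b (rfl | hb)
    · rw [hyx]; exact zero_mem _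
    · exact absurd hb (Set.notMem_empty b)
  have nE1 : ∀ z ∈ envIdeal k (insert x ∅), z * E' ∈ envIdeal k (insert x ∅) := by
    refine mul_envDiff_mem_envIdeal ?_
    rintro b (rfl | hb)
    · rw [hEx]; exact Algebra.subset_adjoin (Set.mem_insert _ _)
    · exact absurd hb (Set.notMem_empty b)
  have nD1 : ∀ z ∈ envIdeal k (insert x ∅), z * D' ∈ envIdeal k (insert x ∅) := by
    refine mul_envDiff_mem_envIdeal ?_
    rintro b (rfl | hb)
    · rw [hDx]; exact zero_mem _
    · exact absurd hb (Set.notMem_empty b)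
  have nDG1 : ∀ z ∈ envIdeal k (insert x ∅), z * (D' - G) ∈ envIdeal k (insert x ∅) := by
    refine mul_mem_envIdeal ?_
    rintro b (rfl | hb)
    · have : envDiff k b * (D' - G) = (D' - G) • envDiff k b := by
        rw [smul_eq_mul, mul_sub, sub_mul, hGx, ← sub_eq_zero.1 hDx']
      rw [this]
      exact Submodule.smul_mem _ _ (hdiff (Set.mem_insert _ _))
    · exact absurd hb (Set.notMem_empty b)
  have nD2 : ∀ z ∈ envIdeal k (insert y (insert x ∅)),
      z * D' ∈ envIdeal k (insert y (insert x ∅)) := by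
    refine mul_envDiff_mem_envIdeal ?_
    rintro b (rfl | rfl | hb)
    · rw [hDy]; exact hf
    · rw [hDx]; exact zero_mem _
    · exact absurd hb (Set.notMem_empty b)
  have nE2 : ∀ z ∈ envIdeal k (insert y (insert x ∅)),
      z * E' ∈ envIdeal k (insert y (insert x ∅)) := by
    refine mul_envDiff_mem_envIdeal ?_
    rintro b (rfl | rfl | hb)
    · rw [hEy]; exact Algebra.subset_adjoin (Set.mem_insert _ _)
    · rw [hEx]; exact Algebra.subset_adjoin (Set.mem_insert_of_mem _ (Set.mem_insert _ _))
    · exact absurd hb (Set.notMem_empty b)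
  have nE3 : ∀ z ∈ envIdeal k (insert D (insert y (insert x ∅))),
      z * E' ∈ envIdeal k (insert D (insert y (insert x ∅))) := by
    refine mul_envDiff_mem_envIdeal ?_
    rintro b (rfl | rfl | rfl | hb)
    · rw [hED]
      exact mul_mem (intCast_mem _ r) (Algebra.subset_adjoin (Set.mem_insert _ _))
    · rw [hEy]; exact Algebra.subset_adjoin (Set.mem_insert_of_mem _ (Set.mem_insert _ _))
    · rw [hEx]
      exact Algebra.subset_adjoin (Set.mem_insert_of_mem _ (Set.mem_insert_of_mem _
        (Set.mem_insert _ _)))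
    · exact absurd hb (Set.notMem_empty b)
  have hθ : ∀ {a b : A}, σ a = a + b →
      (twistedFlip σ (envDiff k a - 1 ⊗ₜ[k] op b)).unop = -envDiff k a := by
    intro a b hab
    rw [← twistedFlip_twistedDiff σ a, hab, MulOpposite.op_add, TensorProduct.tmul_add, envDiff,
      sub_sub]
  have hθ0 : ∀ {a : A}, σ a = a → (twistedFlip σ (envDiff k a)).unop = -envDiff k a := by
    intro a ha
    have := hθ (a := a) (b := 0) (by rw [ha, add_zero])
    rwa [MulOpposite.op_zero, TensorProduct.tmul_zero, sub_zero] at this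
  -- the iterated presentations
  obtain ⟨ρ0, h0, T0⟩ :=
    exists_isDualPresentation_of_eq_bot (twistedFlip σ) (envIdeal_empty k (A := A))
  obtain ⟨ρ1, h1, T1⟩ := h0.exists_envIdeal_insert (nempty x') hx (T0 x' (nempty x'))
    (by rw [hθ0 hσx, neg_add_cancel]; exact zero_mem _)
  have Ty1 : IsTranspose ρ1 y' ny1 y' := T1 y' y' y' (nempty _) (nempty _) ny1
    (by rw [← neg_sub, hyx', neg_zero]; exact zero_mem _) (T0 _ _)
  -- D' and G both commute with x', so crossing x' costs nothing.
  have TD1 : IsTranspose ρ1 (D' - G) nDG1 (D' - G) :=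
    T1 _ (D' - G) _ (nempty _) (nempty _) nDG1
      (by rw [mul_sub, sub_mul, hGx, ← sub_eq_zero.1 hDx', sub_self]; exact zero_mem _) (T0 _ _)
  -- As x'E' = (E' - 1)x', crossing x' lowers the constant by one. The shift r + 1 here is what
  -- remains after E' has crossed D' and y'.
  have TE1 : IsTranspose ρ1 (E' - ((r + 1 : ℤ) : EnvAlg k A)) (mul_sub_intCast_mem nE1 _)
      (E' - ((r + 2 : ℤ) : EnvAlg k A)) := by
    refine T1 _ (E' - ((r + 2 : ℤ) : EnvAlg k A)) _ (nempty _) (nempty _) _ ?_ (T0 _ _)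
    have : x' * (E' - ((r + 1 : ℤ) : EnvAlg k A)) - (E' - ((r + 2 : ℤ) : EnvAlg k A)) * x' =
        x' - (E' * x' - x' * E') := by
      push_cast
      rw [mul_sub, sub_mul, mul_add, add_mul, ← (Int.cast_commute r x').eq, mul_one, two_mul]
      abel
    rw [this, hEx', sub_self]
    exact zero_mem _
  obtain ⟨ρ2, h2, T2⟩ := h1.exists_envIdeal_insert ny1 hy Ty1
    (by rw [hθ0 hσy, neg_add_cancel]; exact zero_mem _)
  -- Modulo the ideal of x, y'D' = (D' - G)y'; the term Hx' is absorbed.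
  have TD2 : IsTranspose ρ2 D' nD2 (D' - G) := by
    refine T2 _ (D' - G) _ nD1 nDG1 nD2 ?_ TD1
    have : y' * D' - (D' - G) * y' = -(H * x') := by
      rw [sub_mul, ← sub_eq_iff_eq_add'.2 hDy']
      abel
    rw [this]
    exact neg_mem (Submodule.smul_mem _ _ (hdiff (Set.mem_insert _ _)))
  have TE2 : IsTranspose ρ2 (E' - (r : EnvAlg k A)) (mul_sub_intCast_mem nE2 _)
      (E' - ((r + 2 : ℤ) : EnvAlg k A)) := by
    refine T2 _ (E' - ((r + 1 : ℤ) : EnvAlg k A)) _ (mul_sub_intCast_mem nE1 _)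
      (mul_sub_intCast_mem nE1 _) _ ?_ TE1
    have : y' * (E' - (r : EnvAlg k A)) - (E' - ((r + 1 : ℤ) : EnvAlg k A)) * y' =
        y' - (E' * y' - y' * E') := by
      push_cast
      rw [mul_sub, sub_mul, add_mul, ← (Int.cast_commute r y').eq, one_mul]
      abel
    rw [this, hEy', sub_self]
    exact zero_mem _
  -- The transpose D' - G differs from the expected D' - 1 ⊗ g by an element that θ sends into the
  -- ideal.
  obtain ⟨ρ3, h3, T3⟩ := h2.exists_envIdeal_insert nD2 hD TD2 (by
    have hsum : D' - G = (D' - 1 ⊗ₜ[k] op g) + (1 ⊗ₜ[k] op g - G) := by abel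
    rw [hsum, map_add, MulOpposite.unop_add, hθ hσD, neg_add_eq_sub, sub_add_cancel]
    exact hG)
  -- Crossing D' contributes r because [E', D'] = rD'. With the crossings of y' and x', the total
  -- shift is r + 2, matching σ(E).
  have TE3 : IsTranspose ρ3 E' nE3 (E' - ((r + 2 : ℤ) : EnvAlg k A)) := by
    refine T3 _ (E' - (r : EnvAlg k A)) _ nE2 (mul_sub_intCast_mem nE2 _) _ ?_ TE2
    have : D' * E' - (E' - (r : EnvAlg k A)) * D' =
        (r : EnvAlg k A) * D' - (E' * D' - D' * E') := by
      rw [sub_mul]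
      abel
    rw [this, hED', sub_self]
    exact zero_mem _
  obtain ⟨ρ4, h4, -⟩ := h3.exists_envIdeal_insert nE3 hE TE3 (by
    have hcast : ((r + 2 : ℤ) : EnvAlg k A) = 1 ⊗ₜ[k] op ((r + 2 : ℤ) : A) :=
      (map_intCast (Algebra.TensorProduct.includeRight : Aᵐᵒᵖ →ₐ[k] EnvAlg k A) (r + 2)).symm
    rw [hcast, hθ hσE, neg_add_cancel]
    exact zero_mem _)
  have : Module.Projective (EnvAlg k A) (EnvAlg k A ⧸ envIdeal k (∅ : Set A)) :=
    Module.Projective.of_equiv (Submodule.quotEquivOfEqBot _ (envIdeal_empty k)).symm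
  -- The bound is five, meaning length at most four: one term for the free module and one step for
  -- each generator.
  have hres := ((((HasFiniteProjectiveResolution.of_projective
    (ModuleCat.of (EnvAlg k A) (EnvAlg k A ⧸ envIdeal k (∅ : Set A)))).envIdeal_insert
      (nempty x') hx).envIdeal_insert ny1 hy).envIdeal_insert nD2 hD).envIdeal_insert nE3 hE
  exact h4.isTwistedCalabiYau hgen hres

end FourGenerators
-- Linear forms and a basis of the logarithmic derivations.
section LinearForms

variable {k : Type u} [Field k]

/-- The partial derivatives are constants, and Euler's identity recovers p from them. -/
theorem MvPolynomial.IsHomogeneous.exists_eq_linear {p : MvPolynomial (Fin 2) k}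
    (hp : p.IsHomogeneous 1) : ∃ a b : k, p = C a * X 0 + C b * X 1 := by
  have hC : ∀ i, ∃ a, pderiv i p = C a := fun i =>
    ⟨_, totalDegree_eq_zero_iff_eq_C.1 (Nat.le_zero.1 (hp.pderiv (i := i)).totalDegree_le)⟩
  obtain ⟨a, ha⟩ := hC 0
  obtain ⟨b, hb⟩ := hC 1
  refine ⟨a, b, ?_⟩
  have h := hp.sum_X_mul_pderiv
  rw [Fin.sum_univ_two, ha, hb, one_smul] at h
  rw [← h]
  ring

theorem MvPolynomial.IsHomogeneous.prime_of_one {p : MvPolynomial (Fin 2) k}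
    (hp : p.IsHomogeneous 1) (h0 : p ≠ 0) : Prime p := by
  refine (irreducible_of_totalDegree_eq_one (hp.totalDegree h0) fun c hc => ?_).prime
  obtain ⟨i, hi⟩ := MvPolynomial.ne_zero_iff.1 h0
  refine isUnit_iff_ne_zero.2 fun h => hi ?_
  have := hc i
  rwa [h, zero_dvd_iff] at this

/-- A linear form with zero locus `L`. -/
def IsLineForm (L : Submodule k (Fin 2 → k)) (p : MvPolynomial (Fin 2) k) : Prop :=
  p.IsHomogeneous 1 ∧ ∀ v : Fin 2 → k, v ∈ L ↔ eval v p = 0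

namespace IsLineForm

variable {L M : Submodule k (Fin 2 → k)} {p q : MvPolynomial (Fin 2) k}

theorem prime (hp : IsLineForm L p) (hL : Module.finrank k L = 1) : Prime p := by
  refine hp.1.prime_of_one ?_
  rintro rfl
  have : L = ⊤ := eq_top_iff.2 fun v _ => (hp.2 v).2 (map_zero _)
  rw [this, finrank_top, Module.finrank_fin_fun] at hL
  exact absurd hL (by decide)

theorem eq_of_dvd (hp : IsLineForm L p) (hq : IsLineForm M q) (hL : Module.finrank k L = 1)
    (hM : Module.finrank k M = 1) (h : p ∣ q) : L = M := by
  refine Submodule.eq_of_le_of_finrank_eq (fun v hv => ?_) (hL.trans hM.symm)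
  obtain ⟨c, rfl⟩ := h
  rw [hq.2, map_mul, (hp.2 v).1 hv, zero_mul]

end IsLineForm

theorem isLineForm_X_zero : IsLineForm (lineXEqZero k) (X 0) :=
  ⟨isHomogeneous_X k 0, fun v => by simp [lineXEqZero]⟩

theorem IsLineForm.exists_eq_C_mul_X {p : MvPolynomial (Fin 2) k}
    (hp : IsLineForm (lineXEqZero k) p) : ∃ a : k, p = C a * X 0 := by
  obtain ⟨a, b, rfl⟩ := hp.1.exists_eq_linear
  have h := (hp.2 ![0, 1]).1 (by simp [lineXEqZero])
  have hb : b = 0 := by simpa using h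
  exact ⟨a, by rw [hb, C_0, zero_mul, add_zero]⟩

theorem IsLineForm.exists_pderiv_one {L : Submodule k (Fin 2 → k)} {p : MvPolynomial (Fin 2) k}
    (hp : IsLineForm L p) (h1 : Module.finrank k L = 1)
    (h1' : Module.finrank k (lineXEqZero k) = 1) (hL : L ≠ lineXEqZero k) :
    ∃ b : k, b ≠ 0 ∧ pderiv 1 p = C b := by
  obtain ⟨a, b, hab⟩ := hp.1.exists_eq_linear
  refine ⟨b, ?_, ?_⟩
  · rintro rfl
    refine hL (isLineForm_X_zero.eq_of_dvd hp h1' h1 ⟨C a, ?_⟩).symm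
    rw [hab, C_0, zero_mul, add_zero, mul_comm]
  · have h01 : pderiv (1 : Fin 2) (X 0 : MvPolynomial (Fin 2) k) = 0 := pderiv_X_of_ne (by decide)
    rw [hab, map_add, pderiv_C_mul, pderiv_C_mul, h01, pderiv_X_self, mul_zero, zero_add,
      mul_one]

namespace CentralLineArrangement.IsDefiningPolynomial

variable {𝒜 : CentralLineArrangement k} {F : MvPolynomial (Fin 2) k}

theorem exists_eq_prod (hline : lineXEqZero k ∈ 𝒜.lines)
    (hQ : 𝒜.IsDefiningPolynomial (X 0 * F)) :
    ∃ (a : k) (T : Finset (Submodule k (Fin 2 → k)))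
      (α : Submodule k (Fin 2 → k) → MvPolynomial (Fin 2) k),
      a ≠ 0 ∧ (∀ L ∈ T, IsLineForm L (α L) ∧ Module.finrank k L = 1 ∧ L ≠ lineXEqZero k) ∧
      F = C a * ∏ L ∈ T, α L := by
  classical
  obtain ⟨α, hα, hF⟩ := hQ
  have h1 := 𝒜.finrank_eq_one _ hline
  have hα0 : IsLineForm (lineXEqZero k) (α (lineXEqZero k)) := hα _ hline
  obtain ⟨a, ha⟩ := hα0.exists_eq_C_mul_X
  refine ⟨a, 𝒜.lines.erase (lineXEqZero k), α, ?_, fun L hL => ?_, ?_⟩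
  · rintro rfl
    exact (hα0.prime h1).ne_zero (by rw [ha, C_0, zero_mul])
  · obtain ⟨hne, hL⟩ := Finset.mem_erase.1 hL
    exact ⟨hα L hL, 𝒜.finrank_eq_one L hL, hne⟩
  · rw [← Finset.mul_prod_erase _ _ hline, ha, mul_comm (C a), mul_assoc] at hF
    exact mul_left_cancel₀ (X_ne_zero 0) hF

theorem not_X_dvd (hline : lineXEqZero k ∈ 𝒜.lines) (hQ : 𝒜.IsDefiningPolynomial (X 0 * F)) :
    ¬ (X 0 : MvPolynomial (Fin 2) k) ∣ F := by
  obtain ⟨a, T, α, ha, hT, rfl⟩ := hQ.exists_eq_prod hline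
  have h1 := 𝒜.finrank_eq_one _ hline
  have hX := isLineForm_X_zero.prime h1
  intro h
  rcases hX.dvd_or_dvd h with h | h
  · exact hX.not_isUnit (isUnit_of_dvd_unit h ((isUnit_iff_ne_zero.2 ha).map C))
  · obtain ⟨L, hL, hdvd⟩ := (hX.dvd_finsetProd_iff _).1 h
    obtain ⟨hα, hfin, hne⟩ := hT L hL
    exact hne (isLineForm_X_zero.eq_of_dvd hα h1 hfin hdvd).symm

theorem ne_zero (hline : lineXEqZero k ∈ 𝒜.lines) (hQ : 𝒜.IsDefiningPolynomial (X 0 * F)) :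
    F ≠ 0 := by
  rintro rfl
  exact hQ.not_X_dvd hline (dvd_zero _)

/-- F is a product of pairwise non-associate linear forms, none proportional to x, so each has a
nonzero constant as y-derivative and F_y is prime to F. -/
theorem dvd_of_dvd_mul_pderiv (hline : lineXEqZero k ∈ 𝒜.lines)
    (hQ : 𝒜.IsDefiningPolynomial (X 0 * F)) {b : MvPolynomial (Fin 2) k}
    (hb : F ∣ b * pderiv 1 F) : F ∣ b := by
  classical
  obtain ⟨a, T, α, ha, hT, rfl⟩ := hQ.exists_eq_prod hline
  have h1 := 𝒜.finrank_eq_one _ hline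
  have hCa : IsUnit (C a : MvPolynomial (Fin 2) k) := (isUnit_iff_ne_zero.2 ha).map C
  have hne : ∀ L ∈ T, ∀ M ∈ T, L ≠ M → ¬ α L ∣ α M := fun L hL M hM hLM h =>
    hLM ((hT L hL).1.eq_of_dvd (hT M hM).1 (hT L hL).2.1 (hT M hM).2.1 h)
  rw [hCa.mul_left_dvd]
  refine Finset.prod_dvd_of_isRelPrime (fun L hL M hM hLM => ?_) fun L hL => ?_
  · exact (((hT L hL).1.prime (hT L hL).2.1).irreducible.isRelPrime_iff_not_dvd).2
      (hne L hL M hM hLM)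
  · obtain ⟨hα, hfin, hLne⟩ := hT L hL
    have hprime := hα.prime hfin
    obtain ⟨c, hc, hpc⟩ := hα.exists_pderiv_one hfin h1 hLne
    -- Modulo the factor of L, F_y is a nonzero constant times the product of the other factors.
    set R := C a * ∏ M ∈ T.erase L, α M with hR
    have hF : C a * ∏ M ∈ T, α M = α L * R := by
      rw [hR, ← Finset.mul_prod_erase _ _ hL]
      ring
    have hdvd : α L ∣ b * (C c * R) := by
      have h := (Dvd.intro R hF.symm).trans hb
      rw [hF, pderiv_mul, hpc, mul_add, ← mul_assoc b (α L), mul_comm b (α L), mul_assoc (α L)] at h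
      exact (dvd_add_left (Dvd.intro _ rfl)).1 h
    rcases hprime.dvd_or_dvd hdvd with h | h
    · exact h
    · exfalso
      rw [((isUnit_iff_ne_zero.2 hc).map C).dvd_mul_left, hR, hCa.dvd_mul_left] at h
      obtain ⟨M, hM, hdvd⟩ := (hprime.dvd_finsetProd_iff _).1 h
      obtain ⟨hML, hM⟩ := Finset.mem_erase.1 hM
      exact hne L hL M hM hML.symm hdvd

/-- The logarithmic derivations of the arrangement are spanned by `E` and `D`. -/
theorem exists_eq_add (hline : lineXEqZero k ∈ 𝒜.lines)
    (hQ : 𝒜.IsDefiningPolynomial (X 0 * F))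
    {δ : Derivation k (MvPolynomial (Fin 2) k) (MvPolynomial (Fin 2) k)}
    (hδ : δ ∈ logDerivations (X 0 * F)) :
    ∃ a b : MvPolynomial (Fin 2) k, δ = a • derE k + b • derD F := by
  have hX := isLineForm_X_zero.prime (𝒜.finrank_eq_one _ hline)
  have h01 : pderiv (1 : Fin 2) (X 0 : MvPolynomial (Fin 2) k) = 0 := pderiv_X_of_ne (by decide)
  have h10 : pderiv (0 : Fin 2) (X 1 : MvPolynomial (Fin 2) k) = 0 := pderiv_X_of_ne (by decide)
  have hE0 : derE k (X 0) = X 0 := by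
    change X 0 * pderiv 0 (X 0) + X 1 * pderiv 1 (X 0) = (X 0 : MvPolynomial (Fin 2) k)
    rw [h01, pderiv_X_self, mul_one, mul_zero, add_zero]
  -- From x ∣ δ(xF) = xδ(F) + Fδ(x) and x ∤ F.
  obtain ⟨a, ha⟩ : X 0 ∣ δ (X 0) := by
    have h : X 0 * F ∣ δ (X 0 * F) := hδ
    rw [Derivation.leibniz, smul_eq_mul, smul_eq_mul] at h
    have h' := (dvd_add_right (Dvd.intro _ rfl)).1 ((Dvd.intro _ rfl).trans h)
    exact (hX.dvd_or_dvd h').resolve_left (hQ.not_X_dvd hline)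
  -- Subtracting a multiple of E kills the ∂_x component; what remains is a multiple of ∂_y whose
  -- coefficient must be divisible by F.
  set δ' := δ - a • derE k with hδ'
  have hδ'0 : δ' (X 0) = 0 := by
    rw [hδ', Derivation.sub_apply, Derivation.smul_apply, hE0, ha, smul_eq_mul, mul_comm, sub_self]
  have hδ'1 : δ' = δ' (X 1) • pderiv 1 := by
    refine MvPolynomial.derivation_ext fun i => ?_
    fin_cases i
    · change δ' (X 0) = δ' (X 1) * pderiv 1 (X 0)
      rw [h01, hδ'0, mul_zero]
    · change δ' (X 1) = δ' (X 1) * pderiv 1 (X 1)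
      rw [pderiv_X_self, mul_one]
  have hmem : X 0 * F ∣ δ' (X 0 * F) :=
    Submodule.sub_mem (logDerivations (X 0 * F)) hδ
      (Submodule.smul_mem _ a (derE_mem hQ))
  obtain ⟨b, hb⟩ : F ∣ δ' (X 1) := by
    refine hQ.dvd_of_dvd_mul_pderiv hline ?_
    rw [Derivation.leibniz, hδ'0, smul_zero, add_zero, smul_eq_mul] at hmem
    have h := (mul_dvd_mul_iff_left (X_ne_zero (0 : Fin 2))).1 hmem
    rw [hδ'1] at h
    exact h
  refine ⟨a, b, ?_⟩
  rw [← sub_eq_iff_eq_add', ← hδ', hδ'1, hb, mul_comm, mul_smul]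
  rfl

end CentralLineArrangement.IsDefiningPolynomial

end LinearForms

/-! ### Divided differences in S ⊗ S. -/

section DividedDifferences

variable {k : Type u} [Field k]

/-- Divided differences: the element `f ⊗ 1 - 1 ⊗ f` of `S ⊗ S` is a combination of
`y ⊗ 1 - 1 ⊗ y` and `x ⊗ 1 - 1 ⊗ x`, and the coefficient of the former is the
partial derivative of `f` on the diagonal. -/
theorem exists_dividedDifference (f : MvPolynomial (Fin 2) k) :
    ∃ G H P R : MvPolynomial (Fin 2) k ⊗[k] MvPolynomial (Fin 2) k,
      f ⊗ₜ[k] 1 - 1 ⊗ₜ[k] f =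
        G * (X 1 ⊗ₜ[k] 1 - 1 ⊗ₜ[k] X 1) + H * (X 0 ⊗ₜ[k] 1 - 1 ⊗ₜ[k] X 0) ∧
      1 ⊗ₜ[k] pderiv 1 f - G =
        P * (X 1 ⊗ₜ[k] 1 - 1 ⊗ₜ[k] X 1) + R * (X 0 ⊗ₜ[k] 1 - 1 ⊗ₜ[k] X 0) := by
  have hl : ∀ p q : MvPolynomial (Fin 2) k,
      (p * q) ⊗ₜ[k] (1 : MvPolynomial (Fin 2) k) = (p ⊗ₜ[k] 1) * (q ⊗ₜ[k] 1) := fun p q => by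
    rw [Algebra.TensorProduct.tmul_mul_tmul, mul_one]
  have hr : ∀ p q : MvPolynomial (Fin 2) k,
      (1 : MvPolynomial (Fin 2) k) ⊗ₜ[k] (p * q) = (1 ⊗ₜ[k] p) * (1 ⊗ₜ[k] q) := fun p q => by
    rw [Algebra.TensorProduct.tmul_mul_tmul, mul_one]
  have h01 : pderiv (1 : Fin 2) (X 0 : MvPolynomial (Fin 2) k) = 0 := pderiv_X_of_ne (by decide)
  induction f using MvPolynomial.induction_on with
  | C c =>
    refine ⟨0, 0, 0, 0, ?_, ?_⟩
    · rw [← mul_one (C c), ← smul_eq_C_mul, TensorProduct.smul_tmul, sub_self]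
      ring
    · rw [pderiv_C, TensorProduct.tmul_zero]
      ring
  | add p q hp hq =>
    obtain ⟨G, H, P, R, h1, h2⟩ := hp
    obtain ⟨G', H', P', R', h1', h2'⟩ := hq
    refine ⟨G + G', H + H', P + P', R + R', ?_, ?_⟩
    · rw [TensorProduct.add_tmul, TensorProduct.tmul_add]
      linear_combination h1 + h1'
    · rw [map_add, TensorProduct.tmul_add]
      linear_combination h2 + h2'
  | mul_X p i hp =>
    obtain ⟨G, H, P, R, h1, h2⟩ := hp
    fin_cases i
    · refine ⟨(1 ⊗ₜ X 0) * G, p ⊗ₜ 1 + (1 ⊗ₜ X 0) * H, (1 ⊗ₜ X 0) * P, (1 ⊗ₜ X 0) * R, ?_, ?_⟩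
      · change (p * X 0) ⊗ₜ[k] 1 - 1 ⊗ₜ[k] (p * X 0) = _
        rw [hl, hr]
        linear_combination (1 ⊗ₜ X 0) * h1
      · change 1 ⊗ₜ[k] pderiv 1 (p * X 0) - _ = _
        rw [pderiv_mul, h01, mul_zero, add_zero, hr]
        linear_combination (1 ⊗ₜ X 0) * h2
    -- The product rule used is py ⊗ 1 - 1 ⊗ py = (p ⊗ 1)(y ⊗ 1 - 1 ⊗ y) + (1 ⊗ y)(p ⊗ 1 - 1 ⊗ p).
    -- The terms -G and -H account for p ⊗ 1 standing in place of 1 ⊗ p.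
    · refine ⟨p ⊗ₜ 1 + (1 ⊗ₜ X 1) * G, (1 ⊗ₜ X 1) * H, (1 ⊗ₜ X 1) * P - G, (1 ⊗ₜ X 1) * R - H,
        ?_, ?_⟩
      · change (p * X 1) ⊗ₜ[k] 1 - 1 ⊗ₜ[k] (p * X 1) = _
        rw [hl, hr]
        linear_combination (1 ⊗ₜ X 1) * h1
      · change 1 ⊗ₜ[k] pderiv 1 (p * X 1) - _ = _
        rw [pderiv_mul, pderiv_X_self, mul_one, TensorProduct.tmul_add, hr]
        linear_combination (1 ⊗ₜ X 1) * h2 - h1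

end DividedDifferences
-- The algebra of tangent operators and conjugation by Q.
section TangentOperators

variable {k : Type u} [Field k]

/-- Multiplication operators, as a homomorphism to the algebra of tangent operators. -/
noncomputable def polyHom (Q : MvPolynomial (Fin 2) k) :
    MvPolynomial (Fin 2) k →ₐ[k] tangentOperators Q where
  toFun := polyOperator Q
  map_one' := Subtype.ext (LinearMap.ext fun g => one_mul g)
  map_mul' f g := Subtype.ext (LinearMap.ext fun h => mul_assoc f g h)
  map_zero' := Subtype.ext (LinearMap.ext fun g => zero_mul g)
  map_add' f g := Subtype.ext (LinearMap.ext fun h => add_mul f g h)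
  commutes' c := Subtype.ext (LinearMap.ext fun g => (Algebra.smul_def c g).symm)

theorem polyHom_coe_apply (Q f g : MvPolynomial (Fin 2) k) :
    (polyHom Q f : Module.End k (MvPolynomial (Fin 2) k)) g = f * g := rfl

theorem tangentOperators_ext {Q : MvPolynomial (Fin 2) k} {a b : tangentOperators Q}
    (h : ∀ g, (a : Module.End k (MvPolynomial (Fin 2) k)) g =
      (b : Module.End k (MvPolynomial (Fin 2) k)) g) : a = b :=
  Subtype.ext (LinearMap.ext h)

theorem polyHom_injective (Q : MvPolynomial (Fin 2) k) : Function.Injective (polyHom Q) := by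
  intro f g h
  have := congrArg (fun a : tangentOperators Q =>
    (a : Module.End k (MvPolynomial (Fin 2) k)) 1) h
  simpa only [polyHom_coe_apply, mul_one] using this

theorem polyHom_commute (Q f g : MvPolynomial (Fin 2) k) :
    polyHom Q f * polyHom Q g = polyHom Q g * polyHom Q f := by
  rw [← map_mul, mul_comm, map_mul]

theorem derOperator_mul_polyHom (Q f : MvPolynomial (Fin 2) k)
    {δ : Derivation k (MvPolynomial (Fin 2) k) (MvPolynomial (Fin 2) k)}
    (hδ : δ ∈ logDerivations Q) :
    derOperator Q δ hδ * polyHom Q f - polyHom Q f * derOperator Q δ hδ = polyHom Q (δ f) := by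
  refine tangentOperators_ext fun g => ?_
  change δ (f * g) - f * δ g = δ f * g
  rw [Derivation.leibniz, smul_eq_mul, smul_eq_mul]
  ring

theorem polyHom_mem_adjoin (Q f : MvPolynomial (Fin 2) k) :
    polyHom Q f ∈ Algebra.adjoin k ({polyHom Q (X 1), polyHom Q (X 0)} : Set (tangentOperators Q)) := by
  induction f using MvPolynomial.induction_on with
  | C c =>
    have : polyHom Q (C c) = algebraMap k _ c := (polyHom Q).commutes c
    rw [this]
    exact Subalgebra.algebraMap_mem _ c
  | add p q hp hq =>
    rw [map_add]
    exact add_mem hp hq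
  | mul_X p i hp =>
    rw [map_mul]
    refine mul_mem hp (Algebra.subset_adjoin ?_)
    fin_cases i
    · exact Set.mem_insert_of_mem _ rfl
    · exact Set.mem_insert _ _

theorem exists_polyHom_eq_of_mem_adjoin (Q : MvPolynomial (Fin 2) k) {a : tangentOperators Q}
    (ha : a ∈ Algebra.adjoin k ({polyHom Q (X 1), polyHom Q (X 0)} : Set (tangentOperators Q))) :
    ∃ f, polyHom Q f = a := by
  suffices Algebra.adjoin k ({polyHom Q (X 1), polyHom Q (X 0)} : Set (tangentOperators Q)) ≤
      (polyHom Q).range from this ha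
  refine Algebra.adjoin_le ?_
  rintro _ (rfl | rfl)
  · exact ⟨_, rfl⟩
  · exact ⟨_, rfl⟩

theorem commute_of_mem_adjoin {A E : Type*} [Ring A] [Algebra k A] [Ring E] [Algebra k E]
    (j : A →ₐ[k] E) {s : E} {S : Set A} (h : ∀ b ∈ S, j b * s = s * j b) :
    ∀ b ∈ Algebra.adjoin k S, j b * s = s * j b := by
  intro b hb
  have hle : Algebra.adjoin k S ≤ (Subalgebra.centralizer k {s}).comap j := by
    refine Algebra.adjoin_le fun b hb => ?_
    rintro _ rfl
    exact (h b hb).symm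
  exact (hle hb s rfl).symm

theorem IsOreVariable.of_adjoin {A E : Type*} [Ring A] [Algebra k A] [Ring E] [Algebra k E]
    {j : A →ₐ[k] E} {s : E} {S : Set A} {t c : A}
    (h1 : ∀ b ∈ S, t * b - b * t ∈ Algebra.adjoin k S) (h2 : ∀ b ∈ S, j b * s = s * j b)
    (h3 : c ∈ Algebra.adjoin k S) (h4 : j t * s - s * j t = j c)
    (h5 : ∀ b ∈ Algebra.adjoin k S, b * c = 0 → b = 0) :
    IsOreVariable j s (Algebra.adjoin k S) t c :=
  ⟨commutator_mem_adjoin h1, commute_of_mem_adjoin j h2, h3, h4, h5⟩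

section Conjugation

variable {Q : MvPolynomial (Fin 2) k}

/-- Conjugation by Q keeps the operator algebra inside itself exactly because Q divides δ(Q): δQ =
Q(δ + δ(Q)/Q) as operators. -/
theorem exists_mul_polyHom_eq (a : tangentOperators Q) :
    ∃ b : tangentOperators Q, a * polyHom Q Q = polyHom Q Q * b := by
  obtain ⟨a, ha⟩ := a
  suffices ∃ b : tangentOperators Q, a * LinearMap.mulLeft k Q =
      LinearMap.mulLeft k Q * (b : Module.End k (MvPolynomial (Fin 2) k)) by
    obtain ⟨b, hb⟩ := this
    exact ⟨b, Subtype.ext hb⟩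
  induction ha using Algebra.adjoin_induction with
  | mem a ha =>
    rcases ha with ⟨f, rfl⟩ | ⟨δ, hδ, rfl⟩
    · refine ⟨polyHom Q f, LinearMap.ext fun g => ?_⟩
      exact mul_left_comm f Q g
    · obtain ⟨c, hc⟩ := id hδ
      refine ⟨derOperator Q δ hδ + polyHom Q c, LinearMap.ext fun g => ?_⟩
      change δ (Q * g) = Q * (δ g + c * g)
      rw [Derivation.leibniz, hc, smul_eq_mul, smul_eq_mul]
      ring
  | algebraMap c =>
    refine ⟨algebraMap k _ c, ?_⟩
    exact Algebra.commutes c _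
  | add a b _ _ ha hb =>
    obtain ⟨a', ha'⟩ := ha
    obtain ⟨b', hb'⟩ := hb
    exact ⟨a' + b', by rw [add_mul, ha', hb', ← mul_add]; rfl⟩
  | mul a b _ _ ha hb =>
    obtain ⟨a', ha'⟩ := ha
    obtain ⟨b', hb'⟩ := hb
    exact ⟨a' * b', by rw [mul_assoc, hb', ← mul_assoc, ha', mul_assoc]; rfl⟩

theorem polyHom_mul_left_cancel {f : MvPolynomial (Fin 2) k} (hf : f ≠ 0)
    {a b : tangentOperators Q} (h : polyHom Q f * a = polyHom Q f * b) : a = b :=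
  tangentOperators_ext fun g => mul_left_cancel₀ hf (congrArg (fun c : tangentOperators Q =>
    (c : Module.End k (MvPolynomial (Fin 2) k)) g) h)

/-- Conjugation by the defining polynomial. -/
noncomputable def conjHom (hQ : Q ≠ 0) : tangentOperators Q →ₐ[k] tangentOperators Q :=
  have h := fun a => (exists_mul_polyHom_eq (Q := Q) a).choose_spec
  AlgHom.ofLinearMap
    { toFun := fun a => (exists_mul_polyHom_eq a).choose
      map_add' := fun a b => polyHom_mul_left_cancel hQ (by
        rw [← h, mul_add, ← h, ← h, add_mul])
      map_smul' := fun c a => polyHom_mul_left_cancel hQ (by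
        rw [← h, RingHom.id_apply, mul_smul_comm, ← h, smul_mul_assoc]) }
    (polyHom_mul_left_cancel hQ ((h 1).symm.trans (by rw [one_mul, mul_one])))
    (fun a b => polyHom_mul_left_cancel hQ ((h (a * b)).symm.trans (by
      change _ = polyHom Q Q * ((exists_mul_polyHom_eq a).choose *
        (exists_mul_polyHom_eq b).choose)
      rw [← mul_assoc, ← h, mul_assoc, mul_assoc, ← h])))

theorem polyHom_mul_conjHom (hQ : Q ≠ 0) (a : tangentOperators Q) :
    polyHom Q Q * conjHom hQ a = a * polyHom Q Q :=
  (exists_mul_polyHom_eq a).choose_spec.symm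

theorem conjHom_eq (hQ : Q ≠ 0) {a b : tangentOperators Q}
    (h : a * polyHom Q Q = polyHom Q Q * b) : conjHom hQ a = b :=
  polyHom_mul_left_cancel hQ ((polyHom_mul_conjHom hQ a).trans h)

theorem conjHom_polyHom (hQ : Q ≠ 0) (f : MvPolynomial (Fin 2) k) :
    conjHom hQ (polyHom Q f) = polyHom Q f :=
  conjHom_eq hQ (polyHom_commute Q f Q)

theorem conjHom_derOperator (hQ : Q ≠ 0)
    {δ : Derivation k (MvPolynomial (Fin 2) k) (MvPolynomial (Fin 2) k)}
    (hδ : δ ∈ logDerivations Q) {c : MvPolynomial (Fin 2) k} (hc : δ Q = Q * c) :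
    conjHom hQ (derOperator Q δ hδ) = derOperator Q δ hδ + polyHom Q c := by
  refine conjHom_eq hQ ?_
  rw [mul_add, ← map_mul, ← hc, ← derOperator_mul_polyHom Q Q hδ]
  exact (add_sub_cancel (polyHom Q Q * derOperator Q δ hδ) (derOperator Q δ hδ * polyHom Q Q)).symm

end Conjugation

end TangentOperators
-- From Ore variables to the Calabi–Yau property.
section IteratedOre

variable {k : Type v} [Field k]

/-- An algebra is free of rank one over a subalgebra which is everything. -/
noncomputable def basisOfEqTop {A : Type*} [Ring A] [Algebra k A] {B : Subalgebra k A}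
    (hB : B = ⊤) : Module.Basis Unit B A :=
  (Module.Basis.singleton Unit B).map (LinearEquiv.ofBijective
    { toFun := Subtype.val
      map_add' := fun _ _ => rfl
      map_smul' := fun _ _ => rfl }
    ⟨Subtype.val_injective, fun a => ⟨⟨a, hB ▸ Algebra.mem_top⟩, rfl⟩⟩)

theorem twistedFlip_envDiff {A : Type u} [Ring A] [Algebra k A] {σ : A ≃ₐ[k] A} {a : A}
    (ha : σ a = a) : (twistedFlip σ (envDiff k a)).unop = -envDiff k a := by
  have := twistedFlip_twistedDiff σ a
  rwa [ha] at this

/-- An iterated Ore extension with the commutation relations of the operators tangent to a line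
arrangement is twisted Calabi-Yau of dimension four. The endomorphism `τ` is the modular
automorphism, the elements `G` and `H` are divided differences of `f = [D, y]`, and `G` has the
value `g` on the diagonal. -/
theorem exists_isTwistedCalabiYau_of_isOreVariable [CharZero k] {A : Type u} [Ring A] [Algebra k A]
    {M : Type*} [Ring M] [Algebra k M] {j : A →ₐ[k] M} (hj : Function.Injective j)
    {x y D E f g c₁ c₂ c₃ c₄ : A} {s₁ s₂ s₃ s₄ : M} {r : ℤ}
    (hgen : Algebra.adjoin k ({E, D, y, x} : Set A) = ⊤)
    (Ox : IsOreVariable j s₁ (Algebra.adjoin k (∅ : Set A)) x c₁)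
    (Oy : IsOreVariable j s₂ (Algebra.adjoin k ({x} : Set A)) y c₂)
    (OD : IsOreVariable j s₃ (Algebra.adjoin k ({y, x} : Set A)) D c₃)
    (OE : IsOreVariable j s₄ (Algebra.adjoin k ({D, y, x} : Set A)) E c₄)
    (hyx : y * x - x * y = 0) (hDx : D * x - x * D = 0) (hDy : D * y - y * D = f)
    (hEx : E * x - x * E = x) (hEy : E * y - y * E = y) (hED : E * D - D * E = (r : A) * D)
    {τ : A →ₐ[k] A} (hτx : τ x = x) (hτy : τ y = y) (hτD : τ D = D + g)
    (hτE : τ E = E + ((r + 2 : ℤ) : A))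
    (hf : f ∈ Algebra.adjoin k ({y, x} : Set A)) (hg : g ∈ Algebra.adjoin k ({y, x} : Set A))
    {G H P R : EnvAlg k A} (hGH : envDiff k f = G * envDiff k y + H * envDiff k x)
    (hGx : G * envDiff k x = envDiff k x * G)
    (hPR : 1 ⊗ₜ[k] op g - G = envDiff k y * P + envDiff k x * R) :
    ∃ σ : A ≃ₐ[k] A, (∀ a, σ a = τ a) ∧ IsTwistedCalabiYau k A 4 σ := by
  obtain ⟨e3, he3⟩ := OE.exists_basis hj (basisOfEqTop hgen)
  obtain ⟨e2, he2⟩ := OD.exists_basis hj e3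
  obtain ⟨e1, he1⟩ := Oy.exists_basis hj e2
  obtain ⟨e0, he0⟩ : ∃ e0 : Module.Basis (ℕ × ℕ × ℕ × ℕ × Unit) (Algebra.adjoin k (∅ : Set A)) A,
      ∀ n i, e0 (n + 1, i) = x * e0 (n, i) :=
    Ox.exists_basis hj (by rw [insert_empty_eq]; exact e1)
  have hτ2 : ∀ b ∈ Algebra.adjoin k ({y, x} : Set A), τ b = b := by
    have hle : Algebra.adjoin k ({y, x} : Set A) ≤ AlgHom.equalizer τ (AlgHom.id k A) := by
      refine Algebra.adjoin_le ?_
      rintro _ (rfl | rfl)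
      · exact hτy
      · exact hτx
    exact fun b hb => hle hb
  have hgmem : g ∈ Algebra.adjoin k ({D, y, x} : Set A) :=
    Algebra.adjoin_mono (Set.subset_insert _ _) hg
  have hτ3 : ∀ b ∈ Algebra.adjoin k ({D, y, x} : Set A),
      τ b ∈ Algebra.adjoin k ({D, y, x} : Set A) := by
    have hle : Algebra.adjoin k ({D, y, x} : Set A) ≤
        (Algebra.adjoin k ({D, y, x} : Set A)).comap τ := by
      refine Algebra.adjoin_le ?_
      rintro b (rfl | hb)
      · change τ b ∈ Algebra.adjoin k _
        rw [hτD]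
        exact add_mem (Algebra.subset_adjoin (Set.mem_insert _ _)) hgmem
      · change τ b ∈ Algebra.adjoin k _
        rw [hτ2 b (Algebra.subset_adjoin hb)]
        exact Algebra.subset_adjoin (Set.mem_insert_of_mem _ hb)
    exact fun b hb => hle hb
  -- Injectivity climbs the tower: τ is the identity on the subalgebra of x and y, and it translates
  -- D and then E by elements of the subalgebra below.
  have hinj3 := OD.injOn_adjoin_insert hj τ (fun b hb => by rwa [hτ2 b hb])
    (fun b hb h => by rwa [hτ2 b hb] at h) hg hτD
  have hinj4 := OE.injOn_adjoin_insert hj τ hτ3 hinj3 (intCast_mem _ _) hτE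
  have hbij : Function.Bijective τ := by
    constructor
    · rw [injective_iff_map_eq_zero]
      exact fun a ha => hinj4 a (by rw [hgen]; exact Algebra.mem_top) ha
    · rw [← AlgHom.range_eq_top, eq_top_iff, ← hgen]
      refine Algebra.adjoin_le ?_
      rintro _ (rfl | rfl | rfl | rfl)
      · exact ⟨_ - ((r + 2 : ℤ) : A),
          (map_sub τ _ _).trans (by rw [hτE, map_intCast, add_sub_cancel_right])⟩
      · exact ⟨_ - g, (map_sub τ _ _).trans (by rw [hτD, hτ2 g hg, add_sub_cancel_right])⟩
      · exact ⟨_, hτy⟩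
      · exact ⟨_, hτx⟩
  refine ⟨AlgEquiv.ofBijective τ hbij, fun a => rfl, ?_⟩
  refine isTwistedCalabiYau_of_generators (r := r) _ hgen hyx hDx hDy hEx hEy hED hτx hτy hτD hτE
    hf hGH hGx ?_
    (mem_envIdeal_of_mul_envDiff_mem e0 he0
      fun b hb => Ox.commutator_mem b (Algebra.subset_adjoin hb))
    (mem_envIdeal_of_mul_envDiff_mem e1 he1
      fun b hb => Oy.commutator_mem b (Algebra.subset_adjoin hb))
    (mem_envIdeal_of_mul_envDiff_mem e2 he2
      fun b hb => OD.commutator_mem b (Algebra.subset_adjoin hb))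
    (mem_envIdeal_of_mul_envDiff_mem e3 he3
      fun b hb => OE.commutator_mem b (Algebra.subset_adjoin hb))
  -- θ reverses products, so y' and x' move to the right end and the result lies in the left ideal.
  rw [hPR, map_add, map_mul, map_mul, MulOpposite.unop_add, MulOpposite.unop_mul,
    MulOpposite.unop_mul, twistedFlip_envDiff (σ := AlgEquiv.ofBijective τ hbij) hτy,
    twistedFlip_envDiff (σ := AlgEquiv.ofBijective τ hbij) hτx]
  refine add_mem (Submodule.smul_mem _ _ (neg_mem (envDiff_mem_envIdeal ?_)))
    (Submodule.smul_mem _ _ (neg_mem (envDiff_mem_envIdeal ?_)))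
  · exact Algebra.subset_adjoin (Set.mem_insert _ _)
  · exact Algebra.subset_adjoin (Set.mem_insert_of_mem _ rfl)

end IteratedOre
-- The generators of the arrangement algebra and the conclusion.
section MainTheorem

variable {k : Type u} [Field k]

theorem derE_apply (f : MvPolynomial (Fin 2) k) :
    derE k f = X 0 * pderiv 0 f + X 1 * pderiv 1 f := rfl

theorem derD_apply (F f : MvPolynomial (Fin 2) k) : derD F f = F * pderiv 1 f := rfl

theorem pderiv_one_X_zero : pderiv (1 : Fin 2) (X 0 : MvPolynomial (Fin 2) k) = 0 :=
  pderiv_X_of_ne (by decide)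

theorem pderiv_zero_X_one : pderiv (0 : Fin 2) (X 1 : MvPolynomial (Fin 2) k) = 0 :=
  pderiv_X_of_ne (by decide)

theorem derE_X (i : Fin 2) : derE k (X i) = X i := by
  fin_cases i
  · change derE k (X 0) = X 0
    rw [derE_apply, pderiv_one_X_zero, pderiv_X_self, mul_one, mul_zero, add_zero]
  · change derE k (X 1) = X 1
    rw [derE_apply, pderiv_zero_X_one, pderiv_X_self, mul_one, mul_zero, zero_add]

theorem derD_X_zero (F : MvPolynomial (Fin 2) k) : derD F (X 0) = 0 := by
  rw [derD_apply, pderiv_one_X_zero, mul_zero]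

theorem derD_X_one (F : MvPolynomial (Fin 2) k) : derD F (X 1) = F := by
  rw [derD_apply, pderiv_X_self, mul_one]

theorem derD_defining (F : MvPolynomial (Fin 2) k) : derD F (X 0 * F) = X 0 * F * pderiv 1 F := by
  rw [derD_apply, pderiv_mul, pderiv_one_X_zero]
  ring

namespace CentralLineArrangement.IsDefiningPolynomial

variable {𝒜 : CentralLineArrangement k} {F : MvPolynomial (Fin 2) k} {r : ℤ}

theorem derE_defining (hcard : (𝒜.lines.card : ℤ) = r + 2)
    (hQ : 𝒜.IsDefiningPolynomial (X 0 * F)) :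
    derE k (X 0 * F) = X 0 * F * ((r + 2 : ℤ) : MvPolynomial (Fin 2) k) := by
  have h := hQ.isHomogeneous.sum_X_mul_pderiv
  rw [Fin.sum_univ_two] at h
  rw [derE_apply, h, nsmul_eq_mul, ← hcard, Int.cast_natCast, mul_comm]

theorem derE_F (hcard : (𝒜.lines.card : ℤ) = r + 2)
    (hQ : 𝒜.IsDefiningPolynomial (X 0 * F)) :
    derE k F = ((r + 1 : ℤ) : MvPolynomial (Fin 2) k) * F := by
  have h := hQ.derE_defining hcard
  rw [Derivation.leibniz, derE_X, smul_eq_mul, smul_eq_mul] at h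
  refine mul_left_cancel₀ (X_ne_zero (0 : Fin 2)) ?_
  push_cast at h ⊢
  linear_combination h

/-- Both sides are derivations in `g`, so it is enough to compare them on x and y; the coefficient r
is the degree r + 1 of F minus the degree 1 of y. -/
theorem derE_derD_sub (hcard : (𝒜.lines.card : ℤ) = r + 2)
    (hQ : 𝒜.IsDefiningPolynomial (X 0 * F)) (g : MvPolynomial (Fin 2) k) :
    derE k (derD F g) - derD F (derE k g) = (r : MvPolynomial (Fin 2) k) * derD F g := by
  have hbr : ⁅derE k, derD F⁆ = (r : MvPolynomial (Fin 2) k) • derD F := by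
    refine MvPolynomial.derivation_ext fun i => ?_
    rw [Derivation.commutator_apply, Derivation.smul_apply, derE_X]
    fin_cases i
    · change derE k (derD F (X 0)) - derD F (X 0) = _ • derD F (X 0)
      rw [derD_X_zero, map_zero, sub_zero, smul_zero]
    · change derE k (derD F (X 1)) - derD F (X 1) = _ • derD F (X 1)
      rw [derD_X_one, hQ.derE_F hcard, smul_eq_mul]
      push_cast
      ring
  have := congrArg (fun δ : Derivation k _ _ => δ g) hbr
  rwa [Derivation.commutator_apply] at this

theorem adjoin_eq_top (hline : lineXEqZero k ∈ 𝒜.lines)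
    (hQ : 𝒜.IsDefiningPolynomial (X 0 * F)) :
    Algebra.adjoin k ({derOperator (X 0 * F) (derE k) (derE_mem hQ),
      derOperator (X 0 * F) (derD F) (derD_mem F), polyHom (X 0 * F) (X 1),
      polyHom (X 0 * F) (X 0)} : Set (tangentOperators (X 0 * F))) = ⊤ := by
  set gen : Set (tangentOperators (X 0 * F)) := {derOperator (X 0 * F) (derE k) (derE_mem hQ),
      derOperator (X 0 * F) (derD F) (derD_mem F), polyHom (X 0 * F) (X 1),
      polyHom (X 0 * F) (X 0)} with hgen
  have hpoly : ∀ f, polyHom (X 0 * F) f ∈ Algebra.adjoin k gen := fun f =>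
    Algebra.adjoin_mono (fun a ha => Set.mem_insert_of_mem _ (Set.mem_insert_of_mem _ ha))
      (polyHom_mem_adjoin (X 0 * F) f)
  have hle : tangentOperators (X 0 * F) ≤
      (Algebra.adjoin k gen).map (tangentOperators (X 0 * F)).val := by
    refine Algebra.adjoin_le ?_
    rintro _ (⟨f, rfl⟩ | ⟨δ, hδ, rfl⟩)
    · exact ⟨_, hpoly f, rfl⟩
    · obtain ⟨a, b, rfl⟩ := hQ.exists_eq_add hline hδ
      refine ⟨polyHom _ a * derOperator (X 0 * F) (derE k) (derE_mem hQ) +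
        polyHom _ b * derOperator (X 0 * F) (derD F) (derD_mem F),
        add_mem (mul_mem (hpoly a) (Algebra.subset_adjoin ?_))
          (mul_mem (hpoly b) (Algebra.subset_adjoin ?_)), rfl⟩
      · exact Set.mem_insert _ _
      · exact Set.mem_insert_of_mem _ (Set.mem_insert _ _)
  refine eq_top_iff.2 fun a _ => ?_
  obtain ⟨b, hb, hab⟩ := hle a.2
  rwa [← Subtype.ext hab]

end CentralLineArrangement.IsDefiningPolynomial

section IntCast

variable {A B : Type*} [Ring A] [Algebra k A] [Ring B] [Algebra k B]

theorem intCast_mul_mem (C : Subalgebra k A) (n : ℤ) {a : A} (ha : a ∈ C) : (n : A) * a ∈ C :=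
  mul_mem (intCast_mem C n) ha

theorem algHom_intCast (f : A →ₐ[k] B) (n : ℤ) : f (n : A) = (n : B) := map_intCast f n

theorem IsOreVariable.of_adjoin_of_commute {j : A →ₐ[k] B} {S : Set A} {t c : A}
    (h1 : ∀ b ∈ S, t * b - b * t ∈ Algebra.adjoin k S) (h2 : ∀ b ∈ S, b * c = c * b)
    (h3 : c ∈ Algebra.adjoin k S) (h4 : t * c - c * t = c) (h5 : ∀ b, c * b = 0 → b = 0) :
    IsOreVariable j (j c) (Algebra.adjoin k S) t c := by
  refine .of_adjoin h1 (fun b hb => ?_) h3 (by rw [← map_mul, ← map_mul, ← map_sub, h4]) ?_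
  · rw [← map_mul, ← map_mul, h2 b hb]
  · intro b hb h
    have := commute_of_mem_adjoin (AlgHom.id k A) h2 b hb
    exact h5 b (this.symm.trans h)

end IntCast

section OreVariables

variable (Q : MvPolynomial (Fin 2) k)

/-- The partial derivative as an endomorphism. -/
noncomputable def pderivEnd (i : Fin 2) : Module.End k (MvPolynomial (Fin 2) k) :=
  (pderiv i : Derivation k (MvPolynomial (Fin 2) k) (MvPolynomial (Fin 2) k))

theorem polyHom_mul_neg_pderivEnd (i : Fin 2) (f : MvPolynomial (Fin 2) k) :
    (tangentOperators Q).val (polyHom Q f) * -pderivEnd i -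
      -pderivEnd i * (tangentOperators Q).val (polyHom Q f) =
        (tangentOperators Q).val (polyHom Q (pderiv i f)) := by
  refine LinearMap.ext fun g => ?_
  change f * -pderiv i g - -pderiv i (f * g) = pderiv i f * g
  rw [pderiv_mul]
  ring

/-- The detecting element -∂_x lives only in the full endomorphism algebra of S; for this reason
`IsOreVariable` allows an overring. -/
theorem isOreVariable_x :
    IsOreVariable (tangentOperators Q).val (-pderivEnd 0)
      (Algebra.adjoin k (∅ : Set (tangentOperators Q))) (polyHom Q (X 0)) 1 := by
  refine .of_adjoin (by simp) (by simp) (one_mem _) ?_ fun b _ h => by rwa [mul_one] at h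
  rw [polyHom_mul_neg_pderivEnd, pderiv_X_self, map_one]

theorem isOreVariable_y :
    IsOreVariable (tangentOperators Q).val (-pderivEnd 1)
      (Algebra.adjoin k ({polyHom Q (X 0)} : Set (tangentOperators Q))) (polyHom Q (X 1)) 1 := by
  refine .of_adjoin ?_ ?_ (one_mem _) ?_ fun b _ h => by rwa [mul_one] at h
  · rintro _ rfl
    rw [polyHom_commute, sub_self]
    exact zero_mem _
  · rintro _ rfl
    rw [← sub_eq_zero, polyHom_mul_neg_pderivEnd, pderiv_one_X_zero, map_zero, map_zero]
  · rw [polyHom_mul_neg_pderivEnd, pderiv_X_self, map_one]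

/-- Multiplication by y detects D: it commutes with S and [D, y] = F is not a zero divisor on S. -/
theorem isOreVariable_D {F : MvPolynomial (Fin 2) k} (hF : F ≠ 0) (hD : derD F ∈ logDerivations Q) :
    IsOreVariable (tangentOperators Q).val ((tangentOperators Q).val (polyHom Q (X 1)))
      (Algebra.adjoin k ({polyHom Q (X 1), polyHom Q (X 0)} : Set (tangentOperators Q)))
      (derOperator Q (derD F) hD) (polyHom Q F) := by
  refine .of_adjoin ?_ ?_ (polyHom_mem_adjoin Q F) ?_ ?_
  · rintro _ (rfl | rfl)
    · rw [derOperator_mul_polyHom]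
      exact polyHom_mem_adjoin Q _
    · rw [derOperator_mul_polyHom]
      exact polyHom_mem_adjoin Q _
  · rintro _ (rfl | rfl)
    · rfl
    · exact congrArg (tangentOperators Q).val (polyHom_commute Q (X 0) (X 1))
  · rw [← map_mul, ← map_mul, ← map_sub, derOperator_mul_polyHom, derD_X_one]
  · intro b hb h
    obtain ⟨g, rfl⟩ := exists_polyHom_eq_of_mem_adjoin Q hb
    rw [← map_mul, map_eq_zero_iff _ (polyHom_injective Q)] at h
    rw [(mul_eq_zero.1 h).resolve_right hF, map_zero]

/-- Multiplication by x detects E: it commutes with D, y and x, while [E, x] = x. Left cancellation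
of x suffices because x commutes with that subalgebra. -/
theorem isOreVariable_E {F : MvPolynomial (Fin 2) k} {r : ℤ}
    (hD : derD F ∈ logDerivations Q) (hE : derE k ∈ logDerivations Q)
    (hED : derOperator Q (derE k) hE * derOperator Q (derD F) hD -
      derOperator Q (derD F) hD * derOperator Q (derE k) hE =
        (r : tangentOperators Q) * derOperator Q (derD F) hD) :
    IsOreVariable (tangentOperators Q).val ((tangentOperators Q).val (polyHom Q (X 0)))
      (Algebra.adjoin k ({derOperator Q (derD F) hD, polyHom Q (X 1), polyHom Q (X 0)} :
        Set (tangentOperators Q)))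
      (derOperator Q (derE k) hE) (polyHom Q (X 0)) := by
  have hmem : ∀ f, polyHom Q f ∈ Algebra.adjoin k ({derOperator Q (derD F) hD, polyHom Q (X 1),
      polyHom Q (X 0)} : Set (tangentOperators Q)) := fun f =>
    Algebra.adjoin_mono (Set.subset_insert _ _) (polyHom_mem_adjoin Q f)
  refine .of_adjoin_of_commute ?_ ?_ (hmem _) ?_ fun b hb =>
    polyHom_mul_left_cancel (X_ne_zero 0) (hb.trans (mul_zero _).symm)
  · rintro _ (rfl | rfl | rfl)
    · rw [hED]
      exact intCast_mul_mem _ r (Algebra.subset_adjoin (Set.mem_insert _ _))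
    · rw [derOperator_mul_polyHom]
      exact hmem _
    · rw [derOperator_mul_polyHom]
      exact hmem _
  · rintro _ (rfl | rfl | rfl)
    · rw [← sub_eq_zero, derOperator_mul_polyHom, derD_X_zero, map_zero]
    · exact polyHom_commute Q (X 1) (X 0)
    · rfl
  · rw [derOperator_mul_polyHom, derE_X]

end OreVariables

/-- The homomorphism from `S ⊗ S` to the enveloping algebra of the tangent operators. -/
noncomputable def polyEnvHom (Q : MvPolynomial (Fin 2) k) :
    MvPolynomial (Fin 2) k ⊗[k] MvPolynomial (Fin 2) k →ₐ[k] EnvAlg k (tangentOperators Q) :=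
  Algebra.TensorProduct.map (polyHom Q)
    ((AlgHom.op (polyHom Q)).comp
      (AlgEquiv.toOpposite k (MvPolynomial (Fin 2) k)).toAlgHom)

theorem polyEnvHom_tmul (Q f g : MvPolynomial (Fin 2) k) :
    polyEnvHom Q (f ⊗ₜ g) = polyHom Q f ⊗ₜ op (polyHom Q g) := rfl

theorem polyEnvHom_diff (Q f : MvPolynomial (Fin 2) k) :
    polyEnvHom Q (f ⊗ₜ 1 - 1 ⊗ₜ f) = envDiff k (polyHom Q f) := by
  rw [map_sub, polyEnvHom_tmul, polyEnvHom_tmul, map_one, MulOpposite.op_one, envDiff]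

end MainTheorem

theorem mainTheorem6 {k : Type u} [Field k] [CharZero k] (r : ℤ)
    (𝒜 : CentralLineArrangement k) (hcard : (𝒜.lines.card : ℤ) = r + 2)
    (hline : lineXEqZero k ∈ 𝒜.lines)
    (F : MvPolynomial (Fin 2) k) (hQ : 𝒜.IsDefiningPolynomial (X 0 * F)) :
    ∃ σ : tangentOperators (X 0 * F) ≃ₐ[k] tangentOperators (X 0 * F),
      σ (polyOperator (X 0 * F) (X 0)) = polyOperator (X 0 * F) (X 0) ∧
      σ (polyOperator (X 0 * F) (X 1)) = polyOperator (X 0 * F) (X 1) ∧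
      σ (derOperator (X 0 * F) (derD F) (derD_mem F)) =
        derOperator (X 0 * F) (derD F) (derD_mem F) + polyOperator (X 0 * F) (pderiv 1 F) ∧
      σ (derOperator (X 0 * F) (derE k) (derE_mem hQ)) =
        derOperator (X 0 * F) (derE k) (derE_mem hQ) + ((r + 2 : ℤ) : tangentOperators (X 0 * F)) ∧
      IsTwistedCalabiYau k (tangentOperators (X 0 * F)) 4 σ := by
  have hF : F ≠ 0 := hQ.ne_zero hline
  have hQ0 : X 0 * F ≠ 0 := mul_ne_zero (X_ne_zero 0) hF
  have hgen := hQ.adjoin_eq_top hline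
  set Q := X 0 * F with hQdef
  set x := polyHom Q (X 0) with hx
  set y := polyHom Q (X 1) with hy
  set D := derOperator Q (derD F) (derD_mem F) with hDdef
  set E := derOperator Q (derE k) (derE_mem hQ) with hEdef
  have hED : E * D - D * E = (r : tangentOperators Q) * D := by
    rw [← algHom_intCast (polyHom Q)]
    exact tangentOperators_ext fun g => hQ.derE_derD_sub hcard g
  have hval : Function.Injective (tangentOperators Q).val := Subtype.val_injective
  have hτE : conjHom hQ0 E = E + ((r + 2 : ℤ) : tangentOperators Q) := by
    rw [← algHom_intCast (polyHom Q)]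
    exact conjHom_derOperator hQ0 _ (hQ.derE_defining hcard)
  have hτD : conjHom hQ0 D = D + polyHom Q (pderiv 1 F) :=
    conjHom_derOperator hQ0 _ (derD_defining F)
  obtain ⟨G, H, P, R, hGH, hPR⟩ := exists_dividedDifference F
  have hGH' := congrArg (polyEnvHom Q) hGH
  rw [map_add, map_mul, map_mul, polyEnvHom_diff, polyEnvHom_diff, polyEnvHom_diff] at hGH'
  have hPR' := congrArg (polyEnvHom Q) hPR
  -- The differences are moved to the left while still in the commutative ring S ⊗ S, so that θ will
  -- later bring them to the right.
  rw [mul_comm P, mul_comm R, map_add, map_mul, map_mul, polyEnvHom_diff, polyEnvHom_diff,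
    map_sub, polyEnvHom_tmul, map_one] at hPR'
  have hGx : polyEnvHom Q G * envDiff k x = envDiff k x * polyEnvHom Q G := by
    rw [hx, ← polyEnvHom_diff, ← map_mul, mul_comm, map_mul]
  have hyx : y * x - x * y = 0 := sub_eq_zero.2 (polyHom_commute Q (X 1) (X 0))
  have hDx : D * x - x * D = 0 := by rw [derOperator_mul_polyHom, derD_X_zero, map_zero]
  have hDy : D * y - y * D = polyHom Q F := by rw [derOperator_mul_polyHom, derD_X_one]
  have hEx : E * x - x * E = x := by rw [derOperator_mul_polyHom, derE_X]
  have hEy : E * y - y * E = y := by rw [derOperator_mul_polyHom, derE_X]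
  obtain ⟨σ, hσ, hCY⟩ := exists_isTwistedCalabiYau_of_isOreVariable hval hgen
    (isOreVariable_x Q) (isOreVariable_y Q) (isOreVariable_D Q hF (derD_mem F))
    (isOreVariable_E Q (derD_mem F) (derE_mem hQ) hED) hyx hDx hDy hEx hEy hED
    (conjHom_polyHom hQ0 (X 0)) (conjHom_polyHom hQ0 (X 1)) hτD hτE
    (polyHom_mem_adjoin Q F) (polyHom_mem_adjoin Q (pderiv 1 F)) hGH' hGx hPR'
  refine ⟨σ, ?_, ?_, ?_, ?_, hCY⟩
  · exact (hσ _).trans (conjHom_polyHom hQ0 (X 0))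
  · exact (hσ _).trans (conjHom_polyHom hQ0 (X 1))
  · exact (hσ _).trans hτD
  · exact (hσ _).trans hτE
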